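/- **Setting.** For a finite set $I$ let $T^I\subset\mathbb R^I$ be the simplex of nonnegative tuples $(\lambda_i)_{i\in I}$ with $\sum_i\lambda_i=1$, and let $T^n=T^{\{0,\dots,n\}}$. The $d$-dimensional faces of $T^n$ are the simplices $F=T^I$ with $I\subseteq\{0,\dots,n\}$, $|I|=d+1$ (included by extending tuples by zero). Let $\mathcal P_r\Lambda^k(\mathbb R^I)$ be the $k$-forms on $\mathbb R^I$ whose coefficients are real polynomials of degree at most $r$ (zero if $r<0$), and let $\mathcal P_r^-\Lambda^k(\mathbb R^I)=i_X\,\mathcal P_{r-1}\Lambda^{k+1}(\mathbb R^I)$, where $i_X$ is contraction in the first argument with the position vector field $X$. Let $\mathcal P_r\Lambda^k(T^I)$ and $\mathcal P_r^-\Lambda^k(T^I)$ be the spaces of restrictions of these forms to $T^I$, and let $\mathring{\mathcal P}_r\Lambda^k(T^I)$ and $\mathring{\mathcal P}_r^-\Lambda^k(T^I)$ be the subspaces of forms whose traces (pullbacks under inclusion) on all codimension-one faces of $T^I$ vanish. A permutation $\pi\in S_{n+1}$ of $\{0,\dots,n\}$ acts on $k$-forms on $T^n$ by $S_\pi^*$,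 where $S_\pi(\lambda_0,\dots,\lambda_n)=(\lambda_{\pi(0)},\dots,\lambda_{\pi(n)})$. Since $S_\pi$ permutes the $d$-dimensional faces, pullback by $S_\pi|_F:F\to S_\pi F$ gives an action on $\bigoplus_{\dim F=d}\mathring{\mathcal P}_r\Lambda^k(F)$, namely $(S_\pi^*\beta)_F=(S_\pi|_F)^*\beta_{S_\pi F}$, and likewise for $\mathcal P^-$. Let $V$ be $\mathcal P_r\Lambda^k(T^n)$ or $\mathcal P_r^-\Lambda^k(T^n)$, and write $\mathring V(F)$ for, respectively, $\mathring{\mathcal P}_r\Lambda^k(F)$ or $\mathring{\mathcal P}_r^-\Lambda^k(F)$. For $0\le d\le n+1$ let $V_d$ be the space of those $\alpha\in V$ whose traces on all $(d-1)$-dimensional faces of $T^n$ vanish (so $V_0=V$ and $V_{n+1}=0$). A choice of *invariant complements* consists of $S_{n+1}$-invariant subspaces $W_d$ with $V_d=W_d\oplus V_{d+1}$ for $0\le d\le n$. **Statement.** Let $n,k\ge0$ and $r\ge1$ be integers. 1. Invariant complements $W_0,\dots,W_n$ exist. 2. For every choice of invariant complements, $V=W_0\oplus\dots\oplus W_n$,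 and the geometric decomposition map $$\mathcal D\colon V\to\bigoplus_{d=0}^n\ \bigoplus_{\dim F=d}\mathring V(F),\qquad \mathcal D(\alpha)=\bigoplus_{\dim F=d}\operatorname{tr}_{T^n,F}\alpha\quad\text{for }\alpha\in W_d,$$ extended linearly, is (well defined and) an isomorphism of $S_{n+1}$-representations. 3. There is an isomorphism of $S_{n+1}$-representations $$\bigoplus_{d=0}^n\ \bigoplus_{\dim F=d}\mathring V(F)\;\cong\;\bigoplus_{d=0}^n\operatorname{Ind}_{S_{d+1}\times S_{n-d}}^{S_{n+1}}\mathring V(T^d).$$ Here $S_{d+1}\times S_{n-d}\subseteq S_{n+1}$ is the stabilizer of $T^d\subseteq T^n$, with $S_{d+1}$ permuting $0,\dots,d$ and $S_{n-d}$ permuting $d+1,\dots,n$. It acts on $\mathring V(T^d)$ by pullback along its action on $T^d$, that is, through the action of the first factor $S_{d+1}$, with $S_{n-d}$ acting trivially. In particular, for $r\ge1$, $$\mathcal P_r\Lambda^k(T^n)\cong\bigoplus_{d=0}^n\bigoplus_{\dim F=d}\mathring{\mathcal P}_r\Lambda^k(F)\cong\bigoplus_{d=0}^n\operatorname{Ind}_{S_{d+1}\times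 S_{n-d}}^{S_{n+1}}\mathring{\mathcal P}_r\Lambda^k(T^d)$$ as $S_{n+1}$-representations, and the same holds with $\mathcal P_r^-$ in place of $\mathcal P_r$. -/

import Mathlib

open scoped DirectSum

namespace FEEC

noncomputable section

/-! ### Polynomial differential forms on `ℝ^ι` -/

/-- Polynomials in the variables `ι` of total degree at most `r`; this is `0` for `r < 0`. -/
def polyLE (ι : Type) (r : ℤ) : Submodule ℝ (MvPolynomial ι ℝ) :=
  MvPolynomial.restrictSupport ℝ {m | (m.degree : ℤ) ≤ r}

/-- A `k`-form on `ℝ^ι`, with no regularity imposed: an alternating `k`-linear form on the tangent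
space at every point. -/
abbrev AmbientForm (ι : Type) (k : ℕ) : Type :=
  (ι → ℝ) → (ι → ℝ) [⋀^Fin k]→ₗ[ℝ] ℝ

/-- `P_r Λ^k(ℝ^ι)`: the `k`-forms on `ℝ^ι` with polynomial coefficients of degree at most `r`, that
is, whose value on any constant vector fields `v 0, …, v (k-1)` is such a polynomial. -/
def polyForms (r : ℤ) (k : ℕ) (ι : Type) : Submodule ℝ (AmbientForm ι k) where
  carrier := {α | ∀ v : Fin k → ι → ℝ, ∃ p ∈ polyLE ι r, ∀ x, α x v = MvPolynomial.eval x p}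
  add_mem' := by
    intro a b ha hb v
    obtain ⟨p, hp, hpa⟩ := ha v
    obtain ⟨q, hq, hqb⟩ := hb v
    exact ⟨p + q, add_mem hp hq, fun x => by simp [hpa, hqb]⟩
  zero_mem' := fun v => ⟨0, zero_mem _, fun x => by simp⟩
  smul_mem' := by
    intro c a ha v
    obtain ⟨p, hp, hpa⟩ := ha v
    exact ⟨c • p, Submodule.smul_mem _ c hp, fun x => by simp [hpa, MvPolynomial.smul_eval]⟩

/-- Contraction `i_X` of a `(k+1)`-form with the position vector field `X`:
`(i_X α)_x (Y₁, …, Y_k) = α_x (x, Y₁, …, Y_k)`. -/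
def contractX (k : ℕ) (ι : Type) : AmbientForm ι (k + 1) →ₗ[ℝ] AmbientForm ι k where
  toFun α := fun x => (α x).curryLeft x
  map_add' _ _ := by ext; simp
  map_smul' _ _ := by ext; simp

/-- `P_r^- Λ^k(ℝ^ι)`: the image of `P_{r-1} Λ^{k+1}(ℝ^ι)` under `i_X`. -/
def polyFormsMinus (r : ℤ) (k : ℕ) (ι : Type) : Submodule ℝ (AmbientForm ι k) :=
  (polyForms (r - 1) (k + 1) ι).map (contractX k ι)

/-! ### Forms on the standard simplex

`T^ι = stdSimplex ℝ ι` is the simplex with vertex set `ι`, in barycentric coordinates. So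
`T^n = T^(Fin (n + 1))`, and the faces of `T^ι` are the simplices `T^I` with `I ⊆ ι`. -/

/-- The (constant) tangent space of `T^ι`: the vectors whose coordinates sum to zero. -/
def tangent (ι : Type) [Fintype ι] : Submodule ℝ (ι → ℝ) :=
  LinearMap.ker (∑ i, LinearMap.proj i : (ι → ℝ) →ₗ[ℝ] ℝ)

/-- `Λ^k(T^ι)`: `k`-forms on the simplex `T^ι`. No regularity is imposed, since only polynomial
forms are used. -/
abbrev Form (ι : Type) [Fintype ι] (k : ℕ) : Type :=
  stdSimplex ℝ ι → tangent ι [⋀^Fin k]→ₗ[ℝ] ℝ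

instance (ι : Type) [Fintype ι] (k : ℕ) : AddCommGroup (Form ι k) := inferInstance

instance (ι : Type) [Fintype ι] (k : ℕ) : Module ℝ (Form ι k) := inferInstance

/-- Restriction of a form on `ℝ^ι` to a form on `T^ι`. -/
def restrict (ι : Type) [Fintype ι] (k : ℕ) : AmbientForm ι k →ₗ[ℝ] Form ι k where
  toFun α := fun x => (α x).compLinearMap (tangent ι).subtype
  map_add' _ _ := by ext; simp
  map_smul' _ _ := by ext; simp

/-- The two families of spaces: `full` is `P_r Λ^k` and `minus` is `P_r^- Λ^k`. -/
inductive Family : Type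
  | full
  | minus

/-- `P_r Λ^k(ℝ^ι)` or `P_r^- Λ^k(ℝ^ι)`. -/
def ambientSpace : Family → (r : ℤ) → (k : ℕ) → (ι : Type) → Submodule ℝ (AmbientForm ι k)
  | .full => polyForms
  | .minus => polyFormsMinus

/-- `P_r Λ^k(T^ι)` or `P_r^- Λ^k(T^ι)`. -/
def space (s : Family) (r : ℤ) (k : ℕ) (ι : Type) [Fintype ι] : Submodule ℝ (Form ι k) :=
  (ambientSpace s r k ι).map (restrict ι k)

section pullback

variable {ι κ μ : Type} [Fintype ι] [Fintype κ] [Fintype μ] {k : ℕ}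

/-- A map `f : ι → κ` of vertices extends to a linear map `ℝ^ι → ℝ^κ` sending `e_i` to `e_{f i}`;
this is its effect on tangent vectors of the simplices. -/
def tangentMap (f : ι → κ) : tangent ι →ₗ[ℝ] tangent κ :=
  (FunOnFinite.linearMap ℝ ℝ f).restrict (by
    intro v hv
    simp only [tangent, LinearMap.mem_ker, LinearMap.sum_apply, LinearMap.proj_apply] at hv ⊢
    classical
    have h : ∀ j, FunOnFinite.linearMap ℝ ℝ f v j = ∑ i with f i = j, v i := fun j => by
      rw [FunOnFinite.linearMap_apply_apply]
    rw [Finset.sum_congr rfl fun j _ => h j, ← hv]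
    convert Finset.sum_fiberwise Finset.univ f (v : ι → ℝ))

/-- Pullback of forms along the affine map `T^ι → T^κ` that sends the vertex `i` to the vertex
`f i`. -/
def pullback (f : ι → κ) : Form κ k →ₗ[ℝ] Form ι k where
  toFun ω := fun x => (ω (stdSimplex.map f x)).compLinearMap (tangentMap f)
  map_add' _ _ := by ext; simp
  map_smul' _ _ := by ext; simp

/-- The trace of a form on `T^ι` on the face `T^I`, `I ⊆ ι`: its pullback along the inclusion. -/
def trace (I : Finset ι) : Form ι k →ₗ[ℝ] Form I k :=
  pullback (Subtype.val : I → ι)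

/-- The forms on `T^ι` whose traces vanish on all faces with `m` vertices, that is, on all faces of
dimension `m - 1`. There is no condition for `m = 0`, because forms on `T^∅ = ∅` are zero. -/
def vanishOn (ι : Type) [Fintype ι] (k m : ℕ) : Submodule ℝ (Form ι k) where
  carrier := {ω | ∀ I : Finset ι, I.card = m → trace I ω = 0}
  add_mem' := by
    intro a b ha hb I hI
    rw [map_add, ha I hI, hb I hI, add_zero]
  zero_mem' := fun I _ => map_zero _
  smul_mem' := by
    intro c a ha I hI
    rw [map_smul, ha I hI, smul_zero]

/-- The forms in `P_r Λ^k(T^ι)` or `P_r^- Λ^k(T^ι)` with vanishing trace on the boundary, that is,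
on all faces of codimension one. -/
def bubble (s : Family) (r : ℤ) (k : ℕ) (ι : Type) [Fintype ι] : Submodule ℝ (Form ι k) :=
  space s r k ι ⊓ vanishOn ι k (Fintype.card ι - 1)

theorem pullback_id (ω : Form ι k) : pullback (id : ι → ι) ω = ω := by
  funext x
  ext v
  have h : ∀ w : tangent ι, tangentMap (id : ι → ι) w = w := by
    intro w
    apply Subtype.ext
    change FunOnFinite.linearMap ℝ ℝ (id : ι → ι) (w : ι → ℝ) = w
    rw [FunOnFinite.linearMap_id]
    rfl
  change ω (stdSimplex.map id x) (fun i => tangentMap id (v i)) = ω x v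
  simp [h]

theorem pullback_comp (g : κ → μ) (f : ι → κ) (ω : Form μ k) :
    pullback (g ∘ f) ω = pullback f (pullback g ω) := by
  funext x
  ext v
  have h : ∀ w : tangent ι, tangentMap (g ∘ f) w = tangentMap g (tangentMap f w) := by
    intro w
    apply Subtype.ext
    change FunOnFinite.linearMap ℝ ℝ (g ∘ f) (w : ι → ℝ) =
      FunOnFinite.linearMap ℝ ℝ g (FunOnFinite.linearMap ℝ ℝ f w)
    rw [FunOnFinite.linearMap_comp]
    rfl
  change ω (stdSimplex.map (g ∘ f) x) (fun i => tangentMap (g ∘ f) (v i)) =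
    ω (stdSimplex.map g (stdSimplex.map f x)) (fun i => tangentMap g (tangentMap f (v i)))
  simp [h, stdSimplex.map_comp_apply]

/-- For a bijection `e`, the linear map `ℝ^ι → ℝ^κ` of `e` is `x ↦ x ∘ e⁻¹`. -/
theorem linearMap_equiv (e : ι ≃ κ) (x : ι → ℝ) :
    FunOnFinite.linearMap ℝ ℝ e x = x ∘ e.symm := by
  classical
  funext j
  rw [FunOnFinite.linearMap_apply_apply, Finset.sum_eq_single (e.symm j)]
  · rfl
  · intro b hb hne
    exact absurd (by simpa using (Finset.mem_filter.1 hb).2 ▸ (e.symm_apply_apply b).symm) hne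
  · intro h
    simp at h

/-- Pullback of forms on `ℝ^κ` along the linear map of a bijection. -/
def ambientPullback (e : ι ≃ κ) (α : AmbientForm κ k) : AmbientForm ι k :=
  fun x => (α (x ∘ e.symm)).compLinearMap (LinearMap.funLeft ℝ ℝ e.symm)

theorem pullback_restrict (e : ι ≃ κ) (α : AmbientForm κ k) :
    pullback e (restrict κ k α) = restrict ι k (ambientPullback e α) := by
  funext x
  ext v
  change α (FunOnFinite.linearMap ℝ ℝ e x) (fun i => FunOnFinite.linearMap ℝ ℝ e (v i : ι → ℝ)) =
    α ((x : ι → ℝ) ∘ e.symm) (fun i => (v i : ι → ℝ) ∘ e.symm)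
  simp only [linearMap_equiv]

theorem ambientPullback_polyForms (e : ι ≃ κ) {r : ℤ} {α : AmbientForm κ k}
    (h : α ∈ polyForms r k κ) : ambientPullback e α ∈ polyForms r k ι := by
  intro v
  obtain ⟨p, hp, hpe⟩ := h fun i => v i ∘ e.symm
  refine ⟨MvPolynomial.rename e.symm p, ?_, fun x => ?_⟩
  · classical
    intro m hm
    replace hm : m ∈ (MvPolynomial.rename e.symm p).support := hm
    rw [MvPolynomial.support_rename_of_injective e.symm.injective, Finset.mem_image] at hm
    obtain ⟨m', hm', rfl⟩ := hm
    have := hp hm'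
    simpa [Finsupp.degree_mapDomain] using this
  · rw [MvPolynomial.eval_rename]
    exact hpe (x ∘ e.symm)

theorem ambientPullback_ambientSpace (e : ι ≃ κ) (s : Family) {r : ℤ} {α : AmbientForm κ k}
    (h : α ∈ ambientSpace s r k κ) : ambientPullback e α ∈ ambientSpace s r k ι := by
  cases s with
  | full => exact ambientPullback_polyForms e h
  | minus =>
    obtain ⟨β, hβ, rfl⟩ := h
    refine ⟨ambientPullback e β, ambientPullback_polyForms e hβ, ?_⟩
    funext x
    ext v
    change β (x ∘ e.symm) _ = β (x ∘ e.symm) _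
    congr 1
    funext i
    refine Fin.cases ?_ (fun j => ?_) i <;> rfl

theorem pullback_space (e : ι ≃ κ) {s : Family} {r : ℤ} {ω : Form κ k}
    (h : ω ∈ space s r k κ) : pullback e ω ∈ space s r k ι := by
  obtain ⟨α, hα, rfl⟩ := h
  exact ⟨ambientPullback e α, ambientPullback_ambientSpace e s hα, (pullback_restrict e α).symm⟩

theorem pullback_vanishOn (e : ι ≃ κ) {m : ℕ} {ω : Form κ k}
    (h : ω ∈ vanishOn κ k m) : pullback e ω ∈ vanishOn ι k m := by
  intro I hI
  let J : Finset κ := I.map e.toEmbedding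
  let f : I → J := fun i => ⟨e i, Finset.mem_map_of_mem _ i.2⟩
  have h1 : trace I (pullback e ω) = pullback f (trace J ω) := by
    unfold trace
    rw [← pullback_comp, ← pullback_comp]
    rfl
  rw [h1, h J (by simpa [J] using hI), map_zero]

theorem pullback_bubble (e : ι ≃ κ) {s : Family} {r : ℤ} {ω : Form κ k}
    (h : ω ∈ bubble s r k κ) : pullback e ω ∈ bubble s r k ι := by
  refine ⟨pullback_space e h.1, pullback_vanishOn e ?_⟩
  rw [Fintype.card_congr e]
  exact h.2

end pullback

/-! ### The actions of the symmetric groups -/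

section action

variable (s : Family) (r : ℤ) (k : ℕ) (ι : Type) [Fintype ι]

/-- The action of `S_ι` on `Λ^k(T^ι)` by `π ↦ S_π^*`, where `S_π(λ) = λ ∘ π`. The map `S_π` sends
the vertex `i` to the vertex `π⁻¹ i`. -/
def formRep : Representation ℝ (Equiv.Perm ι) (Form ι k) where
  toFun π := pullback ⇑π⁻¹
  map_one' := by
    apply LinearMap.ext
    intro ω
    exact pullback_id ω
  map_mul' π σ := by
    apply LinearMap.ext
    intro ω
    change pullback ⇑(π * σ)⁻¹ ω = pullback ⇑π⁻¹ (pullback ⇑σ⁻¹ ω)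
    rw [← pullback_comp, mul_inv_rev]
    rfl

/-- `P_r Λ^k(T^ι)` or `P_r^- Λ^k(T^ι)` as a representation of `S_ι`. -/
def spaceRep : Representation ℝ (Equiv.Perm ι) (space s r k ι) :=
  (formRep k ι).subrepresentation (space s r k ι) fun π _ h => pullback_space π⁻¹ h

/-- The forms in `P_r Λ^k(T^ι)` or `P_r^- Λ^k(T^ι)` with vanishing trace on the boundary, as a
representation of `S_ι`. -/
def bubbleRep : Representation ℝ (Equiv.Perm ι) (bubble s r k ι) :=
  (formRep k ι).subrepresentation (bubble s r k ι) fun π _ h => pullback_bubble π⁻¹ h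

end action

/-- The `d`-dimensional faces of `T^n`, given by their sets of vertices. -/
abbrev Face (n d : ℕ) : Type := {I : Finset (Fin (n + 1)) // I.card = d + 1}

/-- The image of a face under a permutation of the vertices. -/
def Face.image {n d : ℕ} (π : Equiv.Perm (Fin (n + 1))) (F : Face n d) : Face n d :=
  ⟨F.1.map π.toEmbedding, by rw [Finset.card_map, F.2]⟩

/-- The bijection between the vertices of a face and those of its image under a permutation. -/
def Face.equiv {n d : ℕ} (π : Equiv.Perm (Fin (n + 1))) (F : Face n d) :
    F.1 ≃ (F.image π).1 :=
  π.subtypeEquiv fun i => by simp [Face.image]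

/-- The space `⨁_{dim F = d}` of the boundary-vanishing forms in `P_r Λ^k(F)` or `P_r^- Λ^k(F)`; as
there are finitely many faces, the direct sum is a product. -/
abbrev FaceSum (s : Family) (r : ℤ) (k n d : ℕ) : Type :=
  (F : Face n d) → bubble s r k F.1

/-- The action of `S_{n+1}` on the sum over the `d`-dimensional faces of `T^n`: the component of
`S_π^* β` at the face `F` is `(S_π|_F)^* β_{S_π F}`, where `S_π|_F : F → S_π F` sends the vertex `i`
to the vertex `π⁻¹ i`. -/
def faceRep (s : Family) (r : ℤ) (k n d : ℕ) :
    Representation ℝ (Equiv.Perm (Fin (n + 1))) (FaceSum s r k n d) :=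
  have key : ∀ (β : FaceSum s r k n d) (F G G' : Face n d) (f : F.1 → G.1) (f' : F.1 → G'.1),
      G = G' → (∀ i, (f i : Fin (n + 1)) = f' i) →
        pullback f (β G).1 = pullback f' (β G').1 := by
    intro β F G G' f f' hG hf
    subst hG
    have : f = f' := funext fun i => Subtype.ext (hf i)
    rw [this]
  { toFun := fun π =>
      { toFun := fun β F =>
          ⟨pullback (F.equiv π⁻¹) (β (F.image π⁻¹)).1, pullback_bubble _ (β (F.image π⁻¹)).2⟩
        map_add' := fun β γ => by
          funext F
          exact Subtype.ext (map_add _ _ _)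
        map_smul' := fun c β => by
          funext F
          exact Subtype.ext (map_smul _ _ _) }
    map_one' := by
      apply LinearMap.ext
      intro β
      funext F
      apply Subtype.ext
      refine (key β F _ F _ id ?_ fun i => ?_).trans (pullback_id _)
      · apply Subtype.ext
        ext i
        simp only [Face.image, inv_one, Finset.mem_map_equiv]
        rfl
      · rfl
    map_mul' := by
      intro π σ
      apply LinearMap.ext
      intro β
      funext F
      apply Subtype.ext
      refine (key β F _ ((F.image π⁻¹).image σ⁻¹) _
        ((F.image π⁻¹).equiv σ⁻¹ ∘ F.equiv π⁻¹) ?_ fun i => ?_).trans (pullback_comp _ _ _)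
      · apply Subtype.ext
        ext i
        simp only [Face.image, mul_inv_rev, Finset.mem_map_equiv]
        rfl
      · rfl }

/-! ### The geometric decomposition -/

/-- Choices of complements `W_d` of `V_{d+1}` in `V_d` for `d = 0, …, n` that are invariant under
`S_{n+1}`. Here `V_d` consists of the forms in `V` whose traces vanish on all `(d-1)`-dimensional
faces of `T^n`. -/
structure IsInvariantComplements {n k : ℕ} (V : Submodule ℝ (Form (Fin (n + 1)) k))
    (W : Fin (n + 1) → Submodule ℝ (Form (Fin (n + 1)) k)) : Prop where
  disjoint : ∀ d, Disjoint (W d) (V ⊓ vanishOn (Fin (n + 1)) k (d + 1))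
  sup_eq : ∀ d, W d ⊔ (V ⊓ vanishOn (Fin (n + 1)) k (d + 1)) = V ⊓ vanishOn (Fin (n + 1)) k d
  invariant : ∀ d π, ∀ α ∈ W d, formRep k (Fin (n + 1)) π α ∈ W d

/-- `D` is the geometric decomposition map of the complements `W_d`: for `α ∈ W_d`, the components
of `D α` are the traces of `α` on the `d`-dimensional faces, and all others are zero. -/
def IsGeometricDecomposition {s : Family} {r : ℤ} {k n : ℕ}
    (W : Fin (n + 1) → Submodule ℝ (Form (Fin (n + 1)) k))
    (D : space s r k (Fin (n + 1)) →ₗ[ℝ] ⨁ d : Fin (n + 1), FaceSum s r k n d) : Prop :=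
  ∀ (d : Fin (n + 1)) (α : space s r k (Fin (n + 1))), α.1 ∈ W d →
    (∀ F : Face n d, (D α d F).1 = trace F.1 α.1) ∧ ∀ d' ≠ d, D α d' = 0

/-! ### Induction from the stabilizer of a face -/

/-- The embedding of `S_{d+1} × S_{n-d}` as the subgroup of `S_{n+1}` that stabilizes
`T^d ⊆ T^n`: the first factor permutes the vertices `0, …, d` of `T^d` and the second one
the vertices `d+1, …, n`. -/
def stabilizerHom (n : ℕ) (d : Fin (n + 1)) :
    Equiv.Perm (Fin (d + 1)) × Equiv.Perm (Fin (n - d)) →* Equiv.Perm (Fin (n + 1)) :=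
  (finSumFinEquiv.trans (finCongr (by omega)) :
    Fin (d + 1) ⊕ Fin (n - d) ≃ Fin (n + 1)).permCongrHom.toMonoidHom.comp
      (Equiv.Perm.sumCongrHom _ _)

/-- The representation of `S_{n+1}` induced by the boundary-vanishing forms in `P_r Λ^k(T^d)` or
`P_r^- Λ^k(T^d)`, as a representation of the stabilizer `S_{d+1} × S_{n-d}` of `T^d`; the
second factor acts trivially because it fixes `T^d` pointwise. -/
abbrev inducedRep (s : Family) (r : ℤ) (k n : ℕ) (d : Fin (n + 1)) :=
  Representation.ind (stabilizerHom n d)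
    ((bubbleRep s r k (Fin (d + 1))).comp
      (MonoidHom.fst (Equiv.Perm (Fin (d + 1))) (Equiv.Perm (Fin (n - d)))))

end

end FEEC

namespace FEEC

noncomputable section

/-! ### Homogeneous polynomials on the simplex -/

section polynomial

variable {ι : Type} [Fintype ι]

theorem eval_smul_of_isHomogeneous {p : MvPolynomial ι ℝ} {d : ℕ} (hp : p.IsHomogeneous d)
    (t : ℝ) (x : ι → ℝ) :
    MvPolynomial.eval (t • x) p = t ^ d * MvPolynomial.eval x p := by
  rw [MvPolynomial.eval_eq', MvPolynomial.eval_eq', Finset.mul_sum]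
  refine Finset.sum_congr rfl fun m hm => ?_
  have h : m.degree = d := by
    have := hp (MvPolynomial.mem_support_iff.1 hm)
    rwa [Finsupp.degree_eq_weight_one]
  rw [← h, Finsupp.degree_eq_sum, ← Finset.prod_pow_eq_pow_sum]
  simp only [Pi.smul_apply, smul_eq_mul, mul_pow, Finset.prod_mul_distrib]
  ring

/-- A homogeneous polynomial of positive degree that vanishes on the simplex is zero. -/
theorem eq_zero_of_eval_stdSimplex {p : MvPolynomial ι ℝ} {d : ℕ} (hp : p.IsHomogeneous (d + 1))
    (h : ∀ x ∈ stdSimplex ℝ ι, MvPolynomial.eval x p = 0) : p = 0 := by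
  refine MvPolynomial.funext_set (fun _ => Set.Ici (0 : ℝ)) (fun _ => Set.Ici_infinite 0) ?_
  intro x hx
  have hx0 : ∀ i, 0 ≤ x i := fun i => hx i (Set.mem_univ i)
  rw [map_zero]
  set s := ∑ i, x i with hs
  rcases eq_or_ne s 0 with h0 | h0
  · have hxz : x = (0 : ℝ) • x := by
      funext i
      have := (Finset.sum_eq_zero_iff_of_nonneg fun i _ => hx0 i).1 (hs ▸ h0) i (Finset.mem_univ i)
      simp [this]
    rw [hxz, eval_smul_of_isHomogeneous hp]
    simp
  · have hxs : x = s • (s⁻¹ • x) := by rw [smul_smul, mul_inv_cancel₀ h0, one_smul]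
    rw [hxs, eval_smul_of_isHomogeneous hp, h, mul_zero]
    refine ⟨fun i => ?_, ?_⟩
    · exact mul_nonneg (inv_nonneg.2 (Finset.sum_nonneg fun i _ => hx0 i)) (hx0 i)
    · simp only [Pi.smul_apply, smul_eq_mul, ← Finset.mul_sum]
      exact inv_mul_cancel₀ h0

end polynomial

/-! ### Alternating forms with a transverse vector -/

section alternating

variable {ι : Type} [Fintype ι] {k : ℕ}

/-- The projection of `ℝ^ι` onto the hyperplane of vectors with coordinate sum zero, along `a`. -/
def projTangent (a : ι → ℝ) (ha : ∑ i, a i ≠ 0) : (ι → ℝ) →ₗ[ℝ] tangent ι :=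
  LinearMap.codRestrict (tangent ι)
    (LinearMap.id - LinearMap.toSpanSingleton ℝ _ ((∑ i, a i)⁻¹ • a) ∘ₗ
      (∑ i, LinearMap.proj i : (ι → ℝ) →ₗ[ℝ] ℝ)) (by
    intro v
    simp only [tangent, LinearMap.mem_ker, LinearMap.sum_apply, LinearMap.proj_apply,
      LinearMap.sub_apply, LinearMap.id_apply, LinearMap.comp_apply,
      LinearMap.toSpanSingleton_apply, Pi.sub_apply, Pi.smul_apply, smul_eq_mul,
      Finset.sum_sub_distrib, ← Finset.mul_sum]
    field_simp
    ring)

theorem coe_projTangent (a : ι → ℝ) (ha : ∑ i, a i ≠ 0) (v : ι → ℝ) :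
    (projTangent a ha v : ι → ℝ) = v - ((∑ i, v i) * (∑ i, a i)⁻¹) • a := by
  simp [projTangent, smul_smul, Finset.sum_mul, Finset.sum_smul]

theorem coe_projTangent_self (a : ι → ℝ) (ha : ∑ i, a i ≠ 0) :
    (projTangent a ha a : ι → ℝ) = 0 := by
  rw [coe_projTangent, mul_inv_cancel₀ ha, one_smul, sub_self]

theorem coe_projTangent_tangent (a : ι → ℝ) (ha : ∑ i, a i ≠ 0) (v : tangent ι) :
    (projTangent a ha v : ι → ℝ) = v := by
  have h : ∑ i, (v : ι → ℝ) i = 0 := by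
    have := v.2
    simpa [tangent, LinearMap.sum_apply] using this
  rw [coe_projTangent, h, zero_mul, zero_smul, sub_zero]

/-- An alternating form that is annihilated by a transverse vector `a` and vanishes on tangent
vectors is zero. -/
theorem alternating_eq_zero {c : (ι → ℝ) [⋀^Fin k]→ₗ[ℝ] ℝ} {a : ι → ℝ} (ha : ∑ i, a i ≠ 0)
    (hc : ∀ v i, v i = a → c v = 0) (ht : c.compLinearMap (tangent ι).subtype = 0) : c = 0 := by
  ext v
  let t : Fin k → ℝ := fun i => (∑ j, v i j) * (∑ j, a j)⁻¹
  have hv : v = (fun i => (projTangent a ha (v i) : ι → ℝ)) + fun i => t i • a := by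
    funext i
    rw [Pi.add_apply, coe_projTangent, sub_add_cancel]
  rw [hv]
  change c.toMultilinearMap _ = 0
  rw [MultilinearMap.map_add_univ]
  refine Finset.sum_eq_zero fun s _ => ?_
  by_cases hs : s = Finset.univ
  · subst hs
    rw [Finset.piecewise_univ]
    exact DFunLike.congr_fun ht fun i => projTangent a ha (v i)
  · obtain ⟨i, hi⟩ : ∃ i, i ∉ s := by
      by_contra! h
      exact hs (Finset.eq_univ_iff_forall.2 h)
    set w := s.piecewise (fun i => (projTangent a ha (v i) : ι → ℝ)) fun i => t i • a with hw
    have hwi : w i = t i • a := by simp [hw, hi]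
    have : w = Function.update w i (t i • a) := by rw [← hwi, Function.update_eq_self]
    rw [this, MultilinearMap.map_update_smul]
    exact smul_eq_zero_of_right _ (hc _ i (Function.update_self ..))

end alternating

/-! ### Homogeneous lifts of polynomial forms -/

section lift

variable {ι : Type} {k : ℕ}

/-- The form `x^m c`, for an exponent vector `m` and a constant form `c`. -/
def monomialForm (m : ι →₀ ℕ) (c : (ι → ℝ) [⋀^Fin k]→ₗ[ℝ] ℝ) : AmbientForm ι k :=
  fun x => (m.prod fun i e => x i ^ e) • c

/-- Forms with homogeneous polynomial coefficients of degree `r`. -/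
def homogForms (r k : ℕ) (ι : Type) : Submodule ℝ (AmbientForm ι k) :=
  Submodule.span ℝ {α | ∃ (m : ι →₀ ℕ) (c : _), m.degree = r ∧ α = monomialForm m c}

/-- The span of the forms `x^m c` with `m` of degree `r` and `c` a constant form whose contraction
with the vector `m` vanishes. -/
def bernsteinForms (r k : ℕ) (ι : Type) : Submodule ℝ (AmbientForm ι k) :=
  Submodule.span ℝ {α | ∃ (m : ι →₀ ℕ) (c : (ι → ℝ) [⋀^Fin k]→ₗ[ℝ] ℝ), m.degree = r ∧
    (∀ v i, (v i = fun j => (m j : ℝ)) → c v = 0) ∧ α = monomialForm m c}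

/-- A space of forms on `ℝ^ι` that restricts isomorphically to `P_{r+1} Λ^k(T^ι)` or
`P_{r+1}^- Λ^k(T^ι)`. -/
def homogLift : Family → (r k : ℕ) → (ι : Type) → Submodule ℝ (AmbientForm ι k)
  | .full, r, k, ι => bernsteinForms (r + 1) k ι
  | .minus, r, k, ι => (homogForms r (k + 1) ι).map (contractX k ι)

theorem alternating_sum_apply {M σ : Type} [AddCommGroup M] [Module ℝ M] (S : Finset σ)
    (c : σ → M [⋀^Fin k]→ₗ[ℝ] ℝ) (v : Fin k → M) : (∑ i ∈ S, c i) v = ∑ i ∈ S, c i v :=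
  map_sum (⟨⟨fun c => c v, rfl⟩, fun _ _ => rfl⟩ : (M [⋀^Fin k]→ₗ[ℝ] ℝ) →+ ℝ) c S

theorem prod_add_single (m : ι →₀ ℕ) (i : ι) (x : ι → ℝ) :
    ((m + Finsupp.single i 1).prod fun i e => x i ^ e) = x i * m.prod fun i e => x i ^ e := by
  classical
  rw [Finsupp.prod_add_index (fun _ _ => pow_zero _) (fun _ _ _ _ => pow_add _ _ _),
    Finsupp.prod_single_index (h := fun i e => x i ^ e) (pow_zero _), pow_one, mul_comm]

theorem monomialForm_mem_homogForms (m : ι →₀ ℕ) (c : (ι → ℝ) [⋀^Fin k]→ₗ[ℝ] ℝ) :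
    monomialForm m c ∈ homogForms m.degree k ι :=
  Submodule.subset_span ⟨m, c, rfl, rfl⟩

theorem monomialForm_mem_polyForms {m : ι →₀ ℕ} {r : ℤ} (h : (m.degree : ℤ) ≤ r)
    (c : (ι → ℝ) [⋀^Fin k]→ₗ[ℝ] ℝ) : monomialForm m c ∈ polyForms r k ι := by
  intro v
  refine ⟨MvPolynomial.monomial m (c v), ?_, fun x => ?_⟩
  · rw [polyLE, MvPolynomial.mem_restrictSupport_iff]
    intro m' hm'
    have := MvPolynomial.support_monomial_subset hm'
    rw [Finset.mem_singleton] at this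
    subst this
    exact h
  · rw [MvPolynomial.eval_monomial, mul_comm]
    rfl

theorem homogForms_le_polyForms {r : ℕ} : homogForms r k ι ≤ polyForms r k ι := by
  refine Submodule.span_le.2 ?_
  rintro _ ⟨m, c, rfl, rfl⟩
  exact monomialForm_mem_polyForms le_rfl c

theorem bernsteinForms_le_homogForms {r : ℕ} : bernsteinForms r k ι ≤ homogForms r k ι := by
  refine Submodule.span_mono ?_
  rintro _ ⟨m, c, hm, -, rfl⟩
  exact ⟨m, c, hm, rfl⟩

theorem homogLift_le_ambientSpace {s : Family} {r : ℕ} :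
    homogLift s r k ι ≤ ambientSpace s (r + 1) k ι := by
  cases s with
  | full => exact bernsteinForms_le_homogForms.trans (by exact_mod_cast homogForms_le_polyForms)
  | minus =>
    refine Submodule.map_mono ?_
    rw [add_sub_cancel_right]
    exact homogForms_le_polyForms

theorem monomialForm_add_single (m : ι →₀ ℕ) (i : ι) (c : (ι → ℝ) [⋀^Fin k]→ₗ[ℝ] ℝ) (x : ι → ℝ) :
    monomialForm (m + Finsupp.single i 1) c x = x i • monomialForm m c x := by
  simp only [monomialForm, smul_smul, prod_add_single]

theorem bernsteinForms_coeff {r : ℕ} {α : AmbientForm ι k} (hα : α ∈ bernsteinForms r k ι) :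
    ∃ c : (ι →₀ ℕ) → (ι → ℝ) [⋀^Fin k]→ₗ[ℝ] ℝ,
      (∀ m v i, (v i = fun j => (m j : ℝ)) → c m v = 0) ∧ (∀ m, m.degree ≠ r → c m = 0) ∧
      ∀ v, ∃ p : MvPolynomial ι ℝ, (∀ m, p.coeff m = c m v) ∧
        ∀ x, α x v = MvPolynomial.eval x p := by
  classical
  refine Submodule.span_induction ?_ ?_ ?_ ?_ hα
  · rintro _ ⟨m, c, hm, hc, rfl⟩
    refine ⟨Pi.single m c, ?_, ?_, fun v => ⟨MvPolynomial.monomial m (c v), ?_, ?_⟩⟩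
    · intro m' v i hv
      by_cases h : m' = m
      · subst h
        simpa using hc v i hv
      · simp [h]
    · intro m' hm'
      exact Pi.single_eq_of_ne (by rintro rfl; exact hm' hm) _
    · intro m'
      by_cases h : m' = m
      · subst h
        simp
      · simp [h, MvPolynomial.coeff_monomial, Ne.symm h]
    · intro x
      rw [MvPolynomial.eval_monomial, mul_comm]
      rfl
  · exact ⟨0, fun _ _ _ _ => rfl, fun _ _ => rfl, fun _ => ⟨0, fun _ => rfl, fun _ => by simp⟩⟩
  · rintro a b - - ⟨c, hc, hc', hp⟩ ⟨d, hd, hd', hq⟩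
    refine ⟨c + d, fun m v i hv => ?_, fun m hm => ?_, fun v => ?_⟩
    · simp [hc m v i hv, hd m v i hv]
    · simp [hc' m hm, hd' m hm]
    · obtain ⟨p, hp, hpe⟩ := hp v
      obtain ⟨q, hq, hqe⟩ := hq v
      exact ⟨p + q, fun m => by simp [hp, hq], fun x => by simp [hpe, hqe]⟩
  · rintro t a - ⟨c, hc, hc', hp⟩
    refine ⟨t • c, fun m v i hv => ?_, fun m hm => ?_, fun v => ?_⟩
    · simp [hc m v i hv]
    · simp [hc' m hm]
    · obtain ⟨p, hp, hpe⟩ := hp v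
      exact ⟨t • p, fun m => by simp [hp], fun x => by simp [hpe, MvPolynomial.smul_eval]⟩

variable [Fintype ι]

theorem polyForms_le_span {r : ℕ} : polyForms r k ι ≤
    Submodule.span ℝ {α | ∃ (m : ι →₀ ℕ) (c : _), m.degree ≤ r ∧ α = monomialForm m c} := by
  intro α hα
  choose p hp hpe using hα
  have hadd : ∀ (m : ι →₀ ℕ) (u v w : Fin k → ι → ℝ), (∀ x, α x u = α x v + α x w) →
      (p u).coeff m = (p v).coeff m + (p w).coeff m := by
    intro m u v w h
    rw [← MvPolynomial.coeff_add]
    congr 1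
    refine MvPolynomial.funext fun x => ?_
    rw [map_add, ← hpe, ← hpe, ← hpe, h]
  have hsmul : ∀ (m : ι →₀ ℕ) (t : ℝ) (u v : Fin k → ι → ℝ), (∀ x, α x u = t * α x v) →
      (p u).coeff m = t * (p v).coeff m := by
    intro m t u v h
    rw [← smul_eq_mul, ← MvPolynomial.coeff_smul]
    congr 1
    refine MvPolynomial.funext fun x => ?_
    rw [MvPolynomial.smul_eval, ← hpe, ← hpe, h]
  let c : (ι →₀ ℕ) → (ι → ℝ) [⋀^Fin k]→ₗ[ℝ] ℝ := fun m =>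
    { toFun := fun v => (p v).coeff m
      map_update_add' := fun v i x y => hadd _ _ _ _ fun z => by
        convert (α z).map_update_add v i x y
      map_update_smul' := fun v i t x => hsmul _ _ _ _ fun z => by
        convert (α z).map_update_smul v i t x
        exact (smul_eq_mul _ _).symm
      map_eq_zero_of_eq' := fun v i j hij hne => by
        have := hsmul m 0 v v fun z => by
          rw [(α z).map_eq_zero_of_eq v hij hne, mul_zero]
        rwa [zero_mul] at this }
  have hfin : {m : ι →₀ ℕ | m.degree ≤ r}.Finite := Finsupp.finite_of_degree_le r
  have hsum : α = ∑ m ∈ hfin.toFinset, monomialForm m (c m) := by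
    funext x
    ext v
    rw [hpe, MvPolynomial.eval_eq, Finset.sum_apply, alternating_sum_apply]
    refine (Finset.sum_subset ?_ ?_).trans (Finset.sum_congr rfl fun m _ => ?_)
    · intro m hm
      have := (MvPolynomial.mem_restrictSupport_iff ℝ).1 (hp v) hm
      simpa using this
    · intro m _ hm
      rw [MvPolynomial.notMem_support_iff.1 hm, zero_mul]
    · rw [mul_comm]
      rfl
  rw [hsum]
  refine Submodule.sum_mem _ fun m hm => Submodule.subset_span ⟨m, c m, ?_, rfl⟩
  simpa using hm

theorem exists_homogForms_monomialForm (j : ℕ) (m : ι →₀ ℕ) (c : (ι → ℝ) [⋀^Fin k]→ₗ[ℝ] ℝ) :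
    ∃ β ∈ homogForms (m.degree + j) k ι, ∀ x, ∑ i, x i = 1 → monomialForm m c x = β x := by
  induction j generalizing m with
  | zero => exact ⟨_, monomialForm_mem_homogForms m c, fun _ _ => rfl⟩
  | succ j ih =>
    choose β hβ hβe using fun i => ih (m + Finsupp.single i 1)
    refine ⟨∑ i, β i, Submodule.sum_mem _ fun i _ => ?_, fun x hx => ?_⟩
    · have := hβ i
      rwa [map_add, Finsupp.degree_single, add_assoc, add_comm 1 j] at this
    · rw [Finset.sum_apply, Finset.sum_congr rfl fun i _ => (hβe i x hx).symm]
      simp only [monomialForm_add_single]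
      rw [← Finset.sum_smul, hx, one_smul]

/-- Every polynomial form agrees with a homogeneous one on the hyperplane of the simplex. -/
theorem exists_homogForms {r : ℕ} {α : AmbientForm ι k} (hα : α ∈ polyForms r k ι) :
    ∃ β ∈ homogForms r k ι, ∀ x, ∑ i, x i = 1 → α x = β x := by
  refine Submodule.span_induction ?_ ?_ ?_ ?_ (polyForms_le_span hα)
  · rintro _ ⟨m, c, hm, rfl⟩
    obtain ⟨j, rfl⟩ := Nat.exists_eq_add_of_le hm
    exact exists_homogForms_monomialForm j m c
  · exact ⟨0, zero_mem _, fun _ _ => rfl⟩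
  · rintro a b - - ⟨a', ha, ha'⟩ ⟨b', hb, hb'⟩
    exact ⟨a' + b', add_mem ha hb, fun x hx => congrArg₂ (· + ·) (ha' x hx) (hb' x hx)⟩
  · rintro t a - ⟨a', ha, ha'⟩
    exact ⟨t • a', Submodule.smul_mem _ t ha, fun x hx => congrArg (t • ·) (ha' x hx)⟩

theorem restrict_congr {α β : AmbientForm ι k} (h : ∀ x, ∑ i, x i = 1 → α x = β x) :
    restrict ι k α = restrict ι k β := by
  funext x
  exact congrArg (fun c => c.compLinearMap (tangent ι).subtype) (h x x.2.2)

theorem sum_degree_ne_zero {m : ι →₀ ℕ} {r : ℕ} (hm : m.degree = r + 1) :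
    ∑ i, (m i : ℝ) ≠ 0 := by
  rw [← Nat.cast_sum, ← Finsupp.degree_eq_sum, hm]
  exact Nat.cast_ne_zero.2 r.succ_ne_zero

theorem homogForms_restrict_le {r : ℕ} :
    (homogForms (r + 1) k ι).map (restrict ι k) ≤
      (bernsteinForms (r + 1) k ι).map (restrict ι k) := by
  rw [homogForms, Submodule.map_span_le]
  rintro _ ⟨m, c, hm, rfl⟩
  have ha := sum_degree_ne_zero hm
  refine ⟨monomialForm m (c.compLinearMap ((tangent ι).subtype ∘ₗ projTangent _ ha)),
    Submodule.subset_span ⟨m, _, hm, fun v i hv => ?_, rfl⟩, ?_⟩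
  · refine c.map_coord_zero i ?_
    simp [hv, coe_projTangent_self]
  · funext x
    ext v
    simp [restrict, monomialForm, coe_projTangent_tangent]

/-- The homogeneous lifts restrict onto the polynomial forms on the simplex. -/
theorem space_eq_map_homogLift (s : Family) (r k : ℕ) :
    space s (r + 1) k ι = (homogLift s r k ι).map (restrict ι k) := by
  refine le_antisymm ?_ (Submodule.map_mono homogLift_le_ambientSpace)
  rintro _ ⟨α, hα, rfl⟩
  cases s with
  | full =>
    obtain ⟨β, hβ, h⟩ := exists_homogForms (r := r + 1) (by exact_mod_cast hα)
    rw [restrict_congr h]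
    exact homogForms_restrict_le ⟨β, hβ, rfl⟩
  | minus =>
    obtain ⟨γ, hγ, rfl⟩ := hα
    rw [add_sub_cancel_right] at hγ
    obtain ⟨β, hβ, h⟩ := exists_homogForms hγ
    refine ⟨_, ⟨β, hβ, rfl⟩, (restrict_congr fun x hx => ?_).symm⟩
    change (γ x).curryLeft x = (β x).curryLeft x
    rw [h x hx]

theorem contractX_homogForms {r : ℕ} {β : AmbientForm ι (k + 1)}
    (hβ : β ∈ homogForms r (k + 1) ι) (v : Fin k → ι → ℝ) :
    ∃ p : MvPolynomial ι ℝ, p.IsHomogeneous (r + 1) ∧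
      ∀ x, contractX k ι β x v = MvPolynomial.eval x p := by
  classical
  refine Submodule.span_induction ?_ ?_ ?_ ?_ hβ
  · rintro _ ⟨m, c, hm, rfl⟩
    refine ⟨∑ i, MvPolynomial.monomial (m + Finsupp.single i 1)
      (c (Matrix.vecCons (Pi.single i 1) v)), ?_, fun x => ?_⟩
    · refine MvPolynomial.IsHomogeneous.sum _ _ _ fun i _ =>
        MvPolynomial.isHomogeneous_monomial _ ?_
      rw [map_add, Finsupp.degree_single, hm]
    · have hx : ∀ x, c (Matrix.vecCons x v) = ∑ i, x i * c (Matrix.vecCons (Pi.single i 1) v) := by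
        intro x
        have h2 : ∀ y, c (Matrix.vecCons y v) = c.curryLeft y v := fun y => rfl
        simp only [h2]
        conv_lhs => rw [pi_eq_sum_univ' x]
        rw [map_sum, alternating_sum_apply]
        simp only [map_smul, AlternatingMap.smul_apply, smul_eq_mul]
      change (m.prod fun i e => x i ^ e) * c (Matrix.vecCons x v) = _
      rw [hx, map_sum, Finset.mul_sum]
      refine Finset.sum_congr rfl fun i _ => ?_
      rw [MvPolynomial.eval_monomial, prod_add_single]
      ring
  · exact ⟨0, MvPolynomial.isHomogeneous_zero _ _ _, fun x => by simp⟩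
  · rintro a b - - ⟨p, hp, hpe⟩ ⟨q, hq, hqe⟩
    exact ⟨p + q, hp.add hq, fun x => by simp [hpe, hqe]⟩
  · rintro t a - ⟨p, hp, hpe⟩
    refine ⟨MvPolynomial.C t * p, ?_, fun x => by simp [hpe]⟩
    simpa using (MvPolynomial.isHomogeneous_C ι t).mul hp

/-- Restriction to the simplex is injective on the homogeneous lifts. -/
theorem homogLift_eq_zero {s : Family} {r : ℕ} {α : AmbientForm ι k}
    (hα : α ∈ homogLift s r k ι) (h : restrict ι k α = 0) : α = 0 := by
  cases s with
  | full =>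
    obtain ⟨c, hc, hc', hp⟩ := bernsteinForms_coeff hα
    have hhom : ∀ v, ∀ p : MvPolynomial ι ℝ, (∀ m, p.coeff m = c m v) →
        p.IsHomogeneous (r + 1) := by
      intro v p hpc m hm
      by_contra hne
      have : m.degree ≠ r + 1 := by rwa [Finsupp.degree_eq_weight_one]
      exact hm (by rw [hpc, hc' m this]; rfl)
    have hzero : ∀ m, c m = 0 := by
      intro m
      by_cases hm : m.degree = r + 1
      · refine alternating_eq_zero (sum_degree_ne_zero hm) (hc m) ?_
        ext v
        obtain ⟨p, hpc, hpe⟩ := hp fun i => v i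
        have : p = 0 := eq_zero_of_eval_stdSimplex (hhom _ p hpc) fun x hx => by
          rw [← hpe]
          exact DFunLike.congr_fun (congrFun h ⟨x, hx⟩) v
        have h2 := hpc m
        rw [this] at h2
        exact h2.symm
      · exact hc' m hm
    funext x
    ext v
    obtain ⟨p, hpc, hpe⟩ := hp v
    have : p = 0 := by
      ext m
      rw [hpc, hzero]
      rfl
    rw [hpe, this, map_zero]
    rfl
  | minus =>
    obtain ⟨β, hβ, rfl⟩ := hα
    have hzero : ∀ x ∈ stdSimplex ℝ ι, contractX k ι β x = 0 := by
      intro x hx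
      refine alternating_eq_zero (a := x) (by rw [hx.2]; exact one_ne_zero) ?_ ?_
      · intro v i hv
        refine (β x).map_eq_zero_of_eq _ (i := 0) (j := i.succ) ?_ (Fin.succ_ne_zero i).symm
        simp [hv]
      · exact congrFun h ⟨x, hx⟩
    funext x
    ext v
    obtain ⟨p, hp, hpe⟩ := contractX_homogForms hβ v
    have : p = 0 := eq_zero_of_eval_stdSimplex hp fun x hx => by
      rw [← hpe, hzero x hx]
      rfl
    rw [hpe, this, map_zero]
    rfl

end lift

/-! ### Pullback along coordinate maps -/

section coordinate

variable {ι κ : Type} {k : ℕ}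

/-- Pullback of forms along a linear map. -/
def linearPullback (L : (ι → ℝ) →ₗ[ℝ] (κ → ℝ)) : AmbientForm κ k →ₗ[ℝ] AmbientForm ι k where
  toFun α := fun x => (α (L x)).compLinearMap L
  map_add' _ _ := rfl
  map_smul' _ _ := rfl

/-- The linear map `ℝ^ι → ℝ^κ` whose coordinate `j` is the coordinate `f j`, or zero if `f` is not
defined at `j`. -/
def coordMap (f : κ ≃. ι) : (ι → ℝ) →ₗ[ℝ] (κ → ℝ) where
  toFun x j := (f j).elim 0 x
  map_add' x y := by
    funext j
    cases h : f j <;> simp [h]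
  map_smul' t x := by
    funext j
    cases h : f j <;> simp [h]

@[to_additive]
theorem prod_eq_prod_elim [Fintype ι] [Fintype κ] {M : Type} [CommMonoid M] (f : κ ≃. ι)
    (G : κ → M) (hG : ∀ j, f j = none → G j = 1) :
    ∏ j, G j = ∏ i, (f.symm i).elim 1 G := by
  have hsome : ∀ j, G j ≠ 1 → (f j).isSome := fun j hj => by
    rw [Option.isSome_iff_ne_none]
    exact fun h => hj (hG j h)
  refine Finset.prod_bij_ne_one (fun j _ hj => (f j).get (hsome j hj))
    (fun _ _ _ => Finset.mem_univ _) ?_ ?_ ?_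
  · intro a _ ha b _ hb hab
    exact f.inj (Option.get_mem (hsome a ha)) (hab ▸ Option.get_mem (hsome b hb))
  · intro i _ hi
    rcases h : f.symm i with _ | j
    · rw [h] at hi
      exact absurd rfl hi
    · rw [h] at hi
      have : f j = some i := f.eq_some_iff.1 h
      exact ⟨j, Finset.mem_univ _, hi, by simp [this]⟩
  · intro j _ hj
    have : f.symm ((f j).get (hsome j hj)) = some j := f.eq_some_iff.2 (by simp)
    rw [this]
    rfl

theorem linearPullback_contractX (L : (ι → ℝ) →ₗ[ℝ] (κ → ℝ)) (β : AmbientForm κ (k + 1)) :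
    linearPullback L (contractX k κ β) = contractX k ι (linearPullback L β) := by
  funext x
  ext v
  change β (L x) _ = β (L x) _
  congr 1
  funext i
  refine Fin.cases ?_ (fun j => ?_) i <;> rfl

variable [Fintype ι] [Fintype κ]

/-- The pullback of a monomial form along a coordinate map is zero or a monomial form. -/
theorem linearPullback_monomialForm (f : κ ≃. ι) (m : κ →₀ ℕ)
    (c : (κ → ℝ) [⋀^Fin k]→ₗ[ℝ] ℝ) :
    linearPullback (coordMap f) (monomialForm m c) = 0 ∨
      ∃ m' : ι →₀ ℕ, m'.degree = m.degree ∧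
        coordMap f (fun i => (m' i : ℝ)) = (fun j => (m j : ℝ)) ∧
        linearPullback (coordMap f) (monomialForm m c) =
          monomialForm m' (c.compLinearMap (coordMap f)) := by
  by_cases hm : ∃ j, f j = none ∧ m j ≠ 0
  · obtain ⟨j, hj, hmj⟩ := hm
    left
    funext x
    have hz : (m.prod fun i e => coordMap f x i ^ e) = 0 := by
      refine Finset.prod_eq_zero (Finsupp.mem_support_iff.2 hmj) ?_
      simp [coordMap, hj, hmj]
    change ((m.prod fun i e => coordMap f x i ^ e) • c).compLinearMap (coordMap f) = 0
    rw [hz, zero_smul]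
    rfl
  · push Not at hm
    right
    refine ⟨Finsupp.equivFunOnFinite.symm fun i => (f.symm i).elim 0 m, ?_, ?_, ?_⟩
    · rw [Finsupp.degree_eq_sum, Finsupp.degree_eq_sum, sum_eq_sum_elim f m hm]
      rfl
    · funext j
      rcases h : f j with _ | i
      · simp [coordMap, h, hm j h]
      · simp [coordMap, h, f.eq_some_iff.2 h]
    · funext x
      have hp : (m.prod fun i e => coordMap f x i ^ e) =
          (Finsupp.equivFunOnFinite.symm fun i => (f.symm i).elim 0 m).prod
            fun i e => x i ^ e := by
        rw [Finsupp.prod_fintype _ _ fun _ => pow_zero _,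
          Finsupp.prod_fintype _ _ fun _ => pow_zero _, prod_eq_prod_elim f]
        · refine Finset.prod_congr rfl fun i _ => ?_
          rcases h : f.symm i with _ | j
          · simp [h]
          · simp [h, coordMap, f.eq_some_iff.1 h]
        · intro j hj
          rw [hm j hj, pow_zero]
      change ((m.prod fun i e => coordMap f x i ^ e) • c).compLinearMap (coordMap f) = _
      rw [hp]
      rfl

/-- The homogeneous lifts are preserved by pullback along coordinate maps. -/
theorem linearPullback_homogLift (f : κ ≃. ι) {s : Family} {r : ℕ} {α : AmbientForm κ k}
    (hα : α ∈ homogLift s r k κ) : linearPullback (coordMap f) α ∈ homogLift s r k ι := by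
  cases s with
  | full =>
    have h : (bernsteinForms (r + 1) k κ).map (linearPullback (coordMap f)) ≤
        bernsteinForms (r + 1) k ι := by
      rw [bernsteinForms, Submodule.map_span_le]
      rintro _ ⟨m, c, hm, hc, rfl⟩
      obtain h0 | ⟨m', hd, hL, h1⟩ := linearPullback_monomialForm f m c
      · rw [h0]
        exact zero_mem _
      · rw [h1]
        refine Submodule.subset_span ⟨m', _, hd.trans hm, fun v i hv => ?_, rfl⟩
        exact hc _ i (by rw [← hL, ← hv])
    exact h ⟨α, hα, rfl⟩
  | minus =>
    obtain ⟨β, hβ, rfl⟩ := hα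
    have h : (homogForms r (k + 1) κ).map (linearPullback (coordMap f)) ≤
        homogForms r (k + 1) ι := by
      rw [homogForms, Submodule.map_span_le]
      rintro _ ⟨m, c, hm, rfl⟩
      obtain h0 | ⟨m', hd, -, h1⟩ := linearPullback_monomialForm f m c
      · rw [h0]
        exact zero_mem _
      · rw [h1]
        exact Submodule.subset_span ⟨m', _, hd.trans hm, rfl⟩
    rw [linearPullback_contractX]
    exact ⟨_, h ⟨β, hβ, rfl⟩, rfl⟩

end coordinate

/-! ### Traces on faces and extension from faces -/

section trace

variable {ι κ : Type} {k : ℕ}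

/-- The inclusion of a set of vertices as a partial bijection. -/
def vertexIncl (I : Finset ι) : I ≃. ι where
  toFun i := some i
  invFun j := by classical exact if h : j ∈ I then some ⟨j, h⟩ else none
  inv i j := by
    by_cases h : j ∈ I
    · simp only [h, dite_true, Option.some_inj]
      exact ⟨fun e => by rw [← e], fun e => Subtype.ext e.symm⟩
    · simp only [h, dite_false, Option.some_inj, reduceCtorEq, false_iff]
      rintro rfl
      exact h i.2

theorem coordMap_vertexIncl (I : Finset ι) (x : ι → ℝ) (i : I) :
    coordMap (vertexIncl I) x i = x i := rfl

theorem coordMap_vertexIncl_symm_of_mem {I : Finset ι} (x : I → ℝ) {j : ι} (h : j ∈ I) :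
    coordMap (vertexIncl I).symm x j = x ⟨j, h⟩ := by
  change ((vertexIncl I).symm j).elim 0 x = _
  rw [(vertexIncl I).eq_some_iff.2 (show vertexIncl I ⟨j, h⟩ = some j from rfl)]
  rfl

theorem coordMap_vertexIncl_symm_of_notMem {I : Finset ι} (x : I → ℝ) {j : ι} (h : j ∉ I) :
    coordMap (vertexIncl I).symm x j = 0 := by
  change ((vertexIncl I).symm j).elim 0 x = _
  have : (vertexIncl I).symm j = none := dif_neg h
  rw [this]
  rfl

variable [Fintype ι] [Fintype κ]

theorem linearMap_subtypeVal (I : Finset ι) :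
    FunOnFinite.linearMap ℝ ℝ (Subtype.val : I → ι) = coordMap (vertexIncl I).symm := by
  classical
  refine LinearMap.ext fun x => funext fun j => ?_
  rw [FunOnFinite.linearMap_apply_apply]
  by_cases h : j ∈ I
  · rw [coordMap_vertexIncl_symm_of_mem _ h, Finset.sum_eq_single ⟨j, h⟩]
    · intro i hi hne
      exact absurd (Subtype.ext (Finset.mem_filter.1 hi).2) hne
    · intro hne
      simp at hne
  · rw [coordMap_vertexIncl_symm_of_notMem _ h]
    refine Finset.sum_eq_zero fun i hi => ?_
    exact absurd ((Finset.mem_filter.1 hi).2 ▸ i.2) h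

theorem trace_restrict (I : Finset ι) (α : AmbientForm ι k) :
    trace I (restrict ι k α) = restrict I k (linearPullback (coordMap (vertexIncl I).symm) α) := by
  funext x
  ext v
  change α (FunOnFinite.linearMap ℝ ℝ Subtype.val x)
    (fun i => FunOnFinite.linearMap ℝ ℝ Subtype.val (v i : I → ℝ)) = _
  rw [linearMap_subtypeVal]
  rfl

theorem trace_mem_space (I : Finset ι) {s : Family} {r : ℕ} {ω : Form ι k}
    (h : ω ∈ space s (r + 1) k ι) : trace I ω ∈ space s (r + 1) k I := by
  rw [space_eq_map_homogLift] at h ⊢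
  obtain ⟨α, hα, rfl⟩ := h
  rw [trace_restrict]
  exact ⟨_, linearPullback_homogLift _ hα, rfl⟩

/-- If the trace of a form on `J` vanishes, then so do those on the faces of `J`, in the form of
pullbacks along injections of vertices with image in `J`. -/
theorem pullback_eq_zero_of_trace {J : Finset ι} {ω : Form ι k} (h : trace J ω = 0) (f : κ → ι)
    (hf : ∀ i, f i ∈ J) : pullback f ω = 0 := by
  have : pullback f ω = pullback (fun i => (⟨f i, hf i⟩ : J)) (trace J ω) := by
    rw [trace, ← pullback_comp]
    rfl
  rw [this, h, map_zero]

theorem vanishOn_zero : vanishOn ι k 0 = ⊤ := by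
  refine eq_top_iff.2 fun ω _ I hI => ?_
  funext x
  have := x.2.2
  rw [Finset.card_eq_zero] at hI
  subst hI
  simp at this

theorem vanishOn_card : vanishOn ι k (Fintype.card ι) = ⊥ := by
  refine eq_bot_iff.2 fun ω hω => ?_
  have := pullback_eq_zero_of_trace (hω Finset.univ Finset.card_univ) id fun _ => Finset.mem_univ _
  rwa [pullback_id] at this

theorem vanishOn_succ_le {m : ℕ} (hm : m < Fintype.card ι) :
    vanishOn ι k (m + 1) ≤ vanishOn ι k m := by
  intro ω hω I hI
  obtain ⟨J, hIJ, hJ⟩ := Finset.exists_superset_card_eq (s := I) (n := m + 1) (by omega) (by omega)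
  exact pullback_eq_zero_of_trace (hω J hJ) _ fun i => hIJ i.2

/-- The trace on a face of a form that vanishes on all smaller faces vanishes on the boundary. -/
theorem trace_mem_bubble {I : Finset ι} {s : Family} {r : ℕ} {ω : Form ι k}
    (h : ω ∈ space s (r + 1) k ι) {m : ℕ} (hω : ω ∈ vanishOn ι k m) (hI : I.card = m + 1) :
    trace I ω ∈ bubble s (r + 1) k I := by
  refine ⟨trace_mem_space I h, fun K hK => ?_⟩
  rw [Fintype.card_coe, hI, Nat.add_sub_cancel] at hK
  rw [trace, trace, ← pullback_comp]
  refine pullback_eq_zero_of_trace (hω (K.map (Function.Embedding.subtype _))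
    (by rw [Finset.card_map, hK])) _ fun i => ?_
  exact Finset.mem_map_of_mem (Function.Embedding.subtype _) i.2

/-- A form with vanishing trace on the boundary of a face extends to a form whose trace on any
other face not containing it vanishes. -/
theorem exists_extension {I : Finset ι} {s : Family} {r : ℕ} {β : Form I k}
    (hβ : β ∈ bubble s (r + 1) k I) :
    ∃ ω ∈ space s (r + 1) k ι, trace I ω = β ∧ ∀ G : Finset ι, ¬ I ⊆ G → trace G ω = 0 := by
  classical
  obtain ⟨hs, hv⟩ := hβ
  rw [space_eq_map_homogLift] at hs ⊢
  obtain ⟨α, hα, rfl⟩ := hs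
  refine ⟨_, ⟨linearPullback (coordMap (vertexIncl I)) α, linearPullback_homogLift _ hα, rfl⟩,
    ?_, fun G hG => ?_⟩
  · rw [trace_restrict]
    congr 1
    have hL : ∀ x, coordMap (vertexIncl I) (coordMap (vertexIncl I).symm x) = x := fun x => by
      funext i
      rw [coordMap_vertexIncl, coordMap_vertexIncl_symm_of_mem _ i.2]
    funext x
    ext v
    change α (coordMap (vertexIncl I) (coordMap (vertexIncl I).symm x))
      (fun i => coordMap (vertexIncl I) (coordMap (vertexIncl I).symm (v i))) = α x v
    simp only [hL]
  · obtain ⟨i₀, hi₀, hi₀G⟩ := Finset.not_subset.1 hG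
    let K : Finset I := Finset.univ.erase ⟨i₀, hi₀⟩
    have hK : trace K (restrict I k α) = 0 := hv K (by
      rw [Finset.card_erase_of_mem (Finset.mem_univ _), Finset.card_univ])
    rw [trace_restrict] at hK
    have hz := homogLift_eq_zero (linearPullback_homogLift _ hα) hK
    have hL : ∀ x : G → ℝ, coordMap (vertexIncl I) (coordMap (vertexIncl G).symm x) =
        coordMap (vertexIncl K).symm (coordMap (vertexIncl K)
          (coordMap (vertexIncl I) (coordMap (vertexIncl G).symm x))) := fun x => by
      funext i
      by_cases hi : i ∈ K
      · rw [coordMap_vertexIncl_symm_of_mem _ hi]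
        rfl
      · rw [coordMap_vertexIncl_symm_of_notMem _ hi]
        have : i = ⟨i₀, hi₀⟩ := by simpa [K] using hi
        subst this
        exact coordMap_vertexIncl_symm_of_notMem _ hi₀G
    rw [trace_restrict]
    have : linearPullback (coordMap (vertexIncl G).symm)
        (linearPullback (coordMap (vertexIncl I)) α) = 0 := by
      funext x
      ext v
      change α (coordMap (vertexIncl I) (coordMap (vertexIncl G).symm x))
        (fun i => coordMap (vertexIncl I) (coordMap (vertexIncl G).symm (v i))) = 0
      rw [hL x, funext fun i => hL (v i)]
      exact DFunLike.congr_fun (congrFun hz _) _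
    rw [this, map_zero]

/-- Forms with vanishing traces on the boundaries can be prescribed on all faces of the same
dimension. -/
theorem exists_trace_eq {s : Family} {r m : ℕ} (hm : m < Fintype.card ι)
    (β : (I : {I : Finset ι // I.card = m + 1}) → bubble s (r + 1) k I.1) :
    ∃ ω ∈ space s (r + 1) k ι ⊓ vanishOn ι k m, ∀ I, trace I.1 ω = (β I).1 := by
  classical
  choose ω hω hωI hωG using fun I => exists_extension (β I).2
  have htr : ∀ I : {I : Finset ι // I.card = m + 1}, trace I.1 (∑ J, ω J) = (β I).1 := by
    intro I
    rw [map_sum, Finset.sum_eq_single I, hωI]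
    · intro J _ hJ
      refine hωG J _ fun hsub => hJ (Subtype.ext ?_)
      exact Finset.eq_of_subset_of_card_le hsub (by rw [I.2, J.2])
    · exact fun h => absurd (Finset.mem_univ _) h
  refine ⟨∑ J, ω J, ⟨Submodule.sum_mem _ fun J _ => hω J, fun K hK => ?_⟩, htr⟩
  obtain ⟨J, hKJ, hJ⟩ := Finset.exists_superset_card_eq (s := K) (n := m + 1) (by omega) (by omega)
  let K' : Finset J := K.subtype (· ∈ J)
  have h1 : trace K' (trace J (∑ J, ω J)) = 0 := by
    rw [htr ⟨J, hJ⟩]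
    refine (β ⟨J, hJ⟩).2.2 K' ?_
    rw [Fintype.card_coe, hJ, Nat.add_sub_cancel]
    refine Eq.trans ?_ hK
    exact (Finset.card_map _).symm.trans
      (congrArg Finset.card (Finset.subtype_map_of_mem fun i hi => hKJ hi))
  have h2 : trace K (∑ J, ω J) =
      pullback (fun i : K => (⟨i, hKJ i.2⟩ : J)) (trace J (∑ J, ω J)) := by
    rw [trace, trace, ← pullback_comp]
    rfl
  rw [h2]
  exact pullback_eq_zero_of_trace h1 _ fun i => by simp [K']

end trace

/-! ### Complements of a filtration -/

section filtration

variable {M : Type} [AddCommGroup M] [Module ℝ M]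

/-- Complements `W d` of `V (d + 1)` in `V d`, for a finite filtration `V` ending in zero, are
independent. -/
theorem iSupIndep_of_filtration {N : ℕ} {V : ℕ → Submodule ℝ M} {W : Fin N → Submodule ℝ M}
    (hdisj : ∀ d : Fin N, Disjoint (W d) (V (d + 1)))
    (hsup : ∀ d : Fin N, W d ⊔ V (d + 1) = V d) : iSupIndep W := by
  have hanti : ∀ d : Fin N, ∀ m : ℕ, m ≤ d → V d ≤ V m := by
    intro d m hm
    refine Nat.decreasingInduction' (P := fun j => V d ≤ V j) (fun j hj _ ih => ?_) hm le_rfl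
    exact ih.trans (hsup ⟨j, hj.trans d.2⟩ ▸ le_sup_right)
  rw [iSupIndep_iff_finsetSum_eq_zero_imp_eq_zero]
  intro s w hw h0 d
  induction d using WellFoundedLT.induction with
  | _ d ih =>
    intro hd
    refine Submodule.disjoint_def.1 (hdisj d) _ (hw d hd) ?_
    rw [← Finset.add_sum_erase s w hd, add_eq_zero_iff_eq_neg] at h0
    rw [h0]
    refine neg_mem (Submodule.sum_mem _ fun j hj => ?_)
    obtain ⟨hne, hjs⟩ := Finset.mem_erase.1 hj
    rcases lt_or_gt_of_ne hne with h | h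
    · rw [ih j h hjs]
      exact zero_mem _
    · exact hanti j _ h ((hsup j ▸ le_sup_left : W j ≤ V j) (hw j hjs))

theorem iSup_eq_of_filtration {N : ℕ} {V : ℕ → Submodule ℝ M} {W : Fin N → Submodule ℝ M}
    (hsup : ∀ d : Fin N, W d ⊔ V (d + 1) = V d) (hbot : V N = ⊥) : ⨆ d, W d = V 0 := by
  have hle : ∀ m ≤ N, V m ≤ V 0 := fun m hm => by
    induction m with
    | zero => exact le_rfl
    | succ m ih => exact (hsup ⟨m, by omega⟩ ▸ le_sup_right).trans (ih (by omega))
  refine le_antisymm (iSup_le fun d => ?_) ?_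
  · exact (hsup d ▸ le_sup_left : W d ≤ V d).trans (hle d d.2.le)
  · refine Nat.decreasingInduction' (P := fun j => V j ≤ ⨆ d, W d) (fun j hj _ ih => ?_)
      (Nat.zero_le N) (hbot ▸ bot_le)
    rw [← hsup ⟨j, hj⟩]
    exact sup_le (le_iSup W ⟨j, hj⟩) ih

end filtration

/-! ### Existence of invariant complements -/

section complements

variable {ι : Type} [Fintype ι] {k : ℕ}

theorem formRep_vanishOn {m : ℕ} (π : Equiv.Perm ι) {ω : Form ι k} (h : ω ∈ vanishOn ι k m) :
    formRep k ι π ω ∈ vanishOn ι k m :=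
  pullback_vanishOn π⁻¹ h

theorem formRep_space {s : Family} {r : ℤ} (π : Equiv.Perm ι) {ω : Form ι k}
    (h : ω ∈ space s r k ι) : formRep k ι π ω ∈ space s r k ι :=
  pullback_space π⁻¹ h

/-- Invariant subspaces of a finite group representation over a field of characteristic zero have
relative invariant complements. -/
theorem exists_invariant_complement {G M : Type} [Group G] [Finite G] [AddCommGroup M]
    [Module ℝ M] (ρ : Representation ℝ G M) {U V : Submodule ℝ M} (hUV : U ≤ V)
    (hU : ∀ g, ∀ x ∈ U, ρ g x ∈ U) (hV : ∀ g, ∀ x ∈ V, ρ g x ∈ V) :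
    ∃ W : Submodule ℝ M, Disjoint W U ∧ W ⊔ U = V ∧ ∀ g, ∀ x ∈ W, ρ g x ∈ W := by
  have : NeZero (Nat.card G : ℝ) := ⟨Nat.cast_ne_zero.2 Nat.card_pos.ne'⟩
  have hss : ρ.IsSemisimpleRepresentation := inferInstance
  obtain ⟨C, hC⟩ := hss.exists_isCompl ⟨U, fun g x => hU g x⟩
  have hdisj : Disjoint U C.toSubmodule := by
    have := congrArg Subrepresentation.toSubmodule (disjoint_iff.1 hC.1)
    exact disjoint_iff.2 this
  have hcod : U ⊔ C.toSubmodule = ⊤ := by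
    have := congrArg Subrepresentation.toSubmodule (codisjoint_iff.1 hC.2)
    exact this
  refine ⟨C.toSubmodule ⊓ V, hdisj.symm.mono_left inf_le_left, ?_, fun g x hx => ?_⟩
  · rw [sup_comm, ← sup_inf_assoc_of_le _ hUV, hcod, top_inf_eq]
  · exact ⟨C.apply_mem_toSubmodule g hx.1, hV g x hx.2⟩

theorem exists_isInvariantComplements (s : Family) (n k : ℕ) (r : ℤ) :
    ∃ W, IsInvariantComplements (space s r k (Fin (n + 1))) W := by
  have h := fun d : Fin (n + 1) => exists_invariant_complement (formRep k (Fin (n + 1)))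
    (inf_le_inf_left (space s r k (Fin (n + 1)))
      (vanishOn_succ_le (k := k) (ι := Fin (n + 1)) (m := d) (by simpa using d.is_le)))
    (fun π ω hω => ⟨formRep_space π hω.1, formRep_vanishOn π hω.2⟩)
    (fun π ω hω => ⟨formRep_space π hω.1, formRep_vanishOn π hω.2⟩)
  choose W h1 h2 h3 using h
  exact ⟨W, h1, h2, h3⟩

end complements

/-! ### The geometric decomposition -/

section decomposition

variable {s : Family} {r n k : ℕ} {W : Fin (n + 1) → Submodule ℝ (Form (Fin (n + 1)) k)}

theorem IsInvariantComplements.iSupIndep {V : Submodule ℝ (Form (Fin (n + 1)) k)}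
    (hW : IsInvariantComplements V W) : iSupIndep W :=
  iSupIndep_of_filtration (V := fun d => V ⊓ vanishOn (Fin (n + 1)) k d) hW.disjoint hW.sup_eq

theorem IsInvariantComplements.iSup_eq {V : Submodule ℝ (Form (Fin (n + 1)) k)}
    (hW : IsInvariantComplements V W) : ⨆ d, W d = V := by
  have hbot : V ⊓ vanishOn (Fin (n + 1)) k (n + 1) = ⊥ := by
    have := vanishOn_card (ι := Fin (n + 1)) (k := k)
    rw [Fintype.card_fin] at this
    rw [this, inf_bot_eq]
  rw [iSup_eq_of_filtration (V := fun d => V ⊓ vanishOn (Fin (n + 1)) k d) hW.sup_eq hbot,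
    vanishOn_zero, inf_top_eq]

theorem IsInvariantComplements.le {V : Submodule ℝ (Form (Fin (n + 1)) k)}
    (hW : IsInvariantComplements V W) (d : Fin (n + 1)) :
    W d ≤ V ⊓ vanishOn (Fin (n + 1)) k d :=
  hW.sup_eq d ▸ le_sup_left

/-- The traces on the `d`-dimensional faces of the forms in `W_d`. -/
def traces (hW : IsInvariantComplements (space s (r + 1) k (Fin (n + 1))) W) (d : Fin (n + 1)) :
    W d →ₗ[ℝ] FaceSum s (r + 1) k n d :=
  LinearMap.pi fun F => LinearMap.codRestrict _ (trace F.1 ∘ₗ (W d).subtype) fun α =>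
    trace_mem_bubble (hW.le d α.2).1 (hW.le d α.2).2 F.2

theorem traces_bijective (hW : IsInvariantComplements (space s (r + 1) k (Fin (n + 1))) W)
    (d : Fin (n + 1)) : Function.Bijective (traces hW d) := by
  constructor
  · rw [injective_iff_map_eq_zero]
    intro α hα
    refine Subtype.ext (Submodule.disjoint_def.1 (hW.disjoint d) _ α.2
      ⟨(hW.le d α.2).1, fun I hI => ?_⟩)
    exact congrArg Subtype.val (congrFun hα ⟨I, hI⟩)
  · intro β
    obtain ⟨ω, hω, htr⟩ := exists_trace_eq (ι := Fin (n + 1)) (by simpa using d.is_le) β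
    rw [← hW.sup_eq d] at hω
    obtain ⟨α, hα, γ, hγ, rfl⟩ := Submodule.mem_sup.1 hω
    refine ⟨⟨α, hα⟩, funext fun F => Subtype.ext ?_⟩
    have := htr F
    rwa [map_add, hγ.2 F.1 F.2, add_zero] at this

theorem faceRep_apply (s : Family) (r : ℤ) (k n d : ℕ) (π : Equiv.Perm (Fin (n + 1)))
    (β : FaceSum s r k n d) (F : Face n d) :
    (faceRep s r k n d π β F).1 = pullback (F.equiv π⁻¹) (β (F.image π⁻¹)).1 := rfl

theorem traces_equivariant (hW : IsInvariantComplements (space s (r + 1) k (Fin (n + 1))) W)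
    (d : Fin (n + 1)) (π : Equiv.Perm (Fin (n + 1))) (α : W d) :
    traces hW d ⟨formRep k (Fin (n + 1)) π α, hW.invariant d π α α.2⟩ =
      faceRep s (r + 1) k n d π (traces hW d α) := by
  funext F
  refine Subtype.ext ?_
  rw [faceRep_apply]
  change pullback _ (pullback _ α.1) = pullback _ (pullback _ α.1)
  rw [← pullback_comp, ← pullback_comp]
  rfl

/-- The space of polynomial forms as the direct sum of the complements. -/
def decompositionEquiv (hW : IsInvariantComplements (space s (r + 1) k (Fin (n + 1))) W) :
    (⨁ d : Fin (n + 1), W d) ≃ₗ[ℝ] space s (r + 1) k (Fin (n + 1)) :=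
  (LinearEquiv.ofInjective (DirectSum.coeLinearMap W) hW.iSupIndep.dfinsupp_lsum_injective).trans
    (LinearEquiv.ofEq _ _ (by rw [DirectSum.range_coeLinearMap, hW.iSup_eq]))

theorem coe_decompositionEquiv_of
    (hW : IsInvariantComplements (space s (r + 1) k (Fin (n + 1))) W) (d : Fin (n + 1)) (α : W d) :
    (decompositionEquiv hW (DirectSum.lof ℝ _ (fun d => W d) d α) : Form (Fin (n + 1)) k) = α :=
  DirectSum.coeLinearMap_lof W d α

/-- The geometric decomposition map as a linear equivalence. -/
def geometricEquiv (hW : IsInvariantComplements (space s (r + 1) k (Fin (n + 1))) W) :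
    space s (r + 1) k (Fin (n + 1)) ≃ₗ[ℝ] ⨁ d : Fin (n + 1), FaceSum s (r + 1) k n d :=
  (decompositionEquiv hW).symm.trans
    (DirectSum.congrLinearEquiv fun d => LinearEquiv.ofBijective _ (traces_bijective hW d))

theorem geometricEquiv_apply (hW : IsInvariantComplements (space s (r + 1) k (Fin (n + 1))) W)
    {d : Fin (n + 1)} (α : space s (r + 1) k (Fin (n + 1))) (hα : α.1 ∈ W d) :
    geometricEquiv hW α = DirectSum.lof ℝ _ _ d (traces hW d ⟨α, hα⟩) := by
  have : α = decompositionEquiv hW (DirectSum.lof ℝ _ (fun d => W d) d ⟨α, hα⟩) :=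
    Subtype.ext (coe_decompositionEquiv_of hW d ⟨α, hα⟩).symm
  conv_lhs => rw [this]
  rw [geometricEquiv, LinearEquiv.trans_apply, LinearEquiv.symm_apply_apply]
  exact DirectSum.lmap_lof
    (fun d => (LinearEquiv.ofBijective _ (traces_bijective hW d)).toLinearMap) d ⟨α, hα⟩

theorem exists_isGeometricDecomposition
    (hW : IsInvariantComplements (space s (r + 1) k (Fin (n + 1))) W) :
    ∃ D : (spaceRep s (r + 1) k (Fin (n + 1))).Equiv
        (Representation.directSum fun d : Fin (n + 1) => faceRep s (r + 1) k n d),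
      IsGeometricDecomposition W D.toLinearMap := by
  refine ⟨Representation.Equiv.mk (geometricEquiv hW) fun π => ?_, fun d α hα => ⟨fun F => ?_,
    fun d' hd' => ?_⟩⟩
  · rw [← LinearMap.cancel_right (decompositionEquiv hW).surjective]
    refine DirectSum.linearMap_ext ℝ fun d => LinearMap.ext fun α => ?_
    set a := decompositionEquiv hW (DirectSum.lof ℝ _ (fun d => W d) d α) with ha
    have haα : a.1 = α := coe_decompositionEquiv_of hW d α
    have hπ : (spaceRep s (r + 1) k (Fin (n + 1)) π a).1 = formRep k (Fin (n + 1)) π α := by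
      rw [← haα]
      rfl
    change geometricEquiv hW (spaceRep s (r + 1) k (Fin (n + 1)) π a) =
      DirectSum.lmap _ (geometricEquiv hW a)
    rw [geometricEquiv_apply hW (d := d) _ (hπ ▸ hW.invariant d π α α.2),
      geometricEquiv_apply hW (d := d) a (haα ▸ α.2), DirectSum.lmap_lof]
    congr 1
    simp only [hπ, haα]
    exact traces_equivariant hW d π α
  · change (geometricEquiv hW α d F).1 = _
    rw [geometricEquiv_apply hW α hα, DirectSum.lof_apply]
    rfl
  · change geometricEquiv hW α d' = 0
    rw [geometricEquiv_apply hW α hα]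
    exact DirectSum.of_eq_of_ne _ _ _ hd'

end decomposition

/-! ### Recognition of induced representations -/

section induced

variable {G H A M X : Type} [Group G] [Group H] [AddCommGroup A] [Module ℝ A] [AddCommGroup M]
  [Module ℝ M] (φ : H →* G) (ρ : Representation ℝ H A) (τ : Representation ℝ G M)

/-- The intertwining map out of an induced representation given by Frobenius reciprocity. -/
def indLift (j : A →ₗ[ℝ] M) (hj : ∀ h a, τ (φ h) (j a) = j (ρ h a)) :
    (Representation.ind φ ρ).IntertwiningMap τ where
  toLinearMap := Representation.Coinvariants.lift _
    (TensorProduct.lift <| (Finsupp.lift _ _ _ fun g => τ g⁻¹ ∘ₗ j) ∘ₗ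
      (MonoidAlgebra.coeffLinearEquiv ℝ).toLinearMap) fun h => by
      ext g a
      simp [← hj]
  isIntertwining' g := by
    ext
    simp

theorem indLift_mk (j : A →ₗ[ℝ] M) (hj : ∀ h a, τ (φ h) (j a) = j (ρ h a)) (g : G) (a : A) :
    indLift φ ρ τ j hj (Representation.IndV.mk φ ρ g a) = τ g⁻¹ (j a) := by
  change (indLift φ ρ τ j hj).toLinearMap _ = _
  simp [indLift]

theorem indMk_map_mul (h : H) (g : G) (a : A) :
    Representation.IndV.mk φ ρ (φ h * g) (ρ h a) = Representation.IndV.mk φ ρ g a := by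
  have := Representation.Coinvariants.mk_self_apply
    (Representation.tprod ((Representation.leftRegular ℝ G).comp φ) ρ) h
    (MonoidAlgebra.single g 1 ⊗ₜ[ℝ] a)
  simpa using this

/-- A representation is induced from `ρ` if it is the direct sum of the translates of a copy of `ρ`
by representatives of the cosets. -/
theorem nonempty_equiv_ind [Fintype X] (j : A →ₗ[ℝ] M)
    (hj : ∀ h a, τ (φ h) (j a) = j (ρ h a)) (g : X → G) (hg : ∀ y, ∃ h x, y = φ h * g x)
    (hbij : Function.Bijective fun a : X → A => ∑ x, τ (g x)⁻¹ (j (a x))) :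
    Nonempty (τ.Equiv (Representation.ind φ ρ)) := by
  classical
  let q : (X → A) →ₗ[ℝ] Representation.IndV φ ρ :=
    ∑ x, Representation.IndV.mk φ ρ (g x) ∘ₗ LinearMap.proj x
  have hq : ∀ a, q a = ∑ x, Representation.IndV.mk φ ρ (g x) (a x) := fun a => by
    simp [q, LinearMap.sum_apply]
  have hcomp : ∀ a, indLift φ ρ τ j hj (q a) = ∑ x, τ (g x)⁻¹ (j (a x)) := fun a => by
    rw [hq, map_sum]
    exact Finset.sum_congr rfl fun x _ => indLift_mk φ ρ τ j hj (g x) (a x)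
  have hmk : ∀ y a, Representation.IndV.mk φ ρ y a ∈ LinearMap.range q := by
    intro y a
    obtain ⟨h, x, rfl⟩ := hg y
    refine ⟨Pi.single x (ρ h⁻¹ a), ?_⟩
    rw [hq, Finset.sum_eq_single x]
    · rw [Pi.single_eq_same, ← indMk_map_mul φ ρ h, ← Module.End.mul_apply, ← map_mul,
        mul_inv_cancel, map_one, Module.End.one_apply]
    · intro z _ hz
      rw [Pi.single_eq_of_ne hz, map_zero]
    · exact fun h => absurd (Finset.mem_univ _) h
  have hsurj : Function.Surjective q := by
    rw [← LinearMap.range_eq_top, ← Submodule.ker_mkQ (LinearMap.range q), LinearMap.ker_eq_top]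
    refine Representation.IndV.hom_ext φ ρ fun y => LinearMap.ext fun a => ?_
    exact (Submodule.Quotient.mk_eq_zero _).2 (hmk y a)
  have hb : Function.Bijective (indLift φ ρ τ j hj) := by
    constructor
    · intro u v huv
      obtain ⟨a, rfl⟩ := hsurj u
      obtain ⟨b, rfl⟩ := hsurj v
      rw [hcomp, hcomp] at huv
      rw [hbij.1 huv]
    · intro m
      obtain ⟨a, ha⟩ := hbij.2 m
      exact ⟨q a, (hcomp a).trans ha⟩
  exact ⟨((indLift φ ρ τ j hj).ofBijective hb).symm⟩

/-- Isomorphisms of representations induce one of direct sums. -/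
theorem nonempty_equiv_directSum {σ : Type} [DecidableEq σ] {V V' : σ → Type}
    [∀ i, AddCommGroup (V i)] [∀ i, Module ℝ (V i)] [∀ i, AddCommGroup (V' i)]
    [∀ i, Module ℝ (V' i)] (ρ : ∀ i, Representation ℝ G (V i))
    (ρ' : ∀ i, Representation ℝ G (V' i)) (h : ∀ i, Nonempty ((ρ i).Equiv (ρ' i))) :
    Nonempty ((Representation.directSum ρ).Equiv (Representation.directSum ρ')) := by
  let e := fun i => (h i).some
  refine ⟨Representation.Equiv.mk (DirectSum.congrLinearEquiv fun i => (e i).toLinearEquiv)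
    fun g => ?_⟩
  refine DirectSum.linearMap_ext ℝ fun i => LinearMap.ext fun x => ?_
  change DirectSum.lmap (fun i => (e i).toLinearEquiv.toLinearMap)
    (DirectSum.lmap _ (DirectSum.lof ℝ σ V i x)) = DirectSum.lmap _
      (DirectSum.lmap (fun i => (e i).toLinearEquiv.toLinearMap) (DirectSum.lof ℝ σ V i x))
  simp only [DirectSum.lmap_lof]
  congr 1
  exact LinearMap.congr_fun ((e i).isIntertwining' g) x

end induced

/-! ### Faces and the stabilizer of the standard face -/

section faces

variable {n : ℕ} {d : Fin (n + 1)}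

theorem stabilizerHom_castLE (p : Equiv.Perm (Fin (d + 1)) × Equiv.Perm (Fin (n - d)))
    (i : Fin (d + 1)) :
    stabilizerHom n d p (i.castLE d.2) = (p.1 i).castLE d.2 := by
  have h : ∀ i : Fin (d + 1), (finSumFinEquiv.trans (finCongr (by omega)) :
      Fin (d + 1) ⊕ Fin (n - d) ≃ Fin (n + 1)) (Sum.inl i) = i.castLE d.2 := fun i => by
    ext
    simp
  rw [← h, ← h]
  simp [stabilizerHom, Equiv.Perm.sumCongrHom]

theorem lt_iff_exists_castLE (i : Fin (n + 1)) :
    (i : ℕ) < d + 1 ↔ ∃ j : Fin (d + 1), j.castLE d.2 = i :=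
  ⟨fun h => ⟨⟨i, h⟩, rfl⟩, by rintro ⟨j, rfl⟩; exact j.2⟩

theorem stabilizerHom_lt (p : Equiv.Perm (Fin (d + 1)) × Equiv.Perm (Fin (n - d)))
    {i : Fin (n + 1)} (hi : (i : ℕ) < d + 1) : (stabilizerHom n d p i : ℕ) < d + 1 := by
  obtain ⟨j, rfl⟩ := (lt_iff_exists_castLE i).1 hi
  rw [stabilizerHom_castLE]
  exact (p.1 j).2

theorem exists_stabilizerHom_eq {π : Equiv.Perm (Fin (n + 1))}
    (hπ : ∀ i : Fin (n + 1), (i : ℕ) < d + 1 → (π i : ℕ) < d + 1) :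
    ∃ p, stabilizerHom n d p = π := by
  let e : Fin (d + 1) ⊕ Fin (n - d) ≃ Fin (n + 1) := finSumFinEquiv.trans (finCongr (by omega))
  have he : ∀ x, (e x : ℕ) < d + 1 ↔ x ∈ Set.range Sum.inl := by
    rintro (x | x)
    · simpa [e] using x.is_le
    · simp [e]
      omega
  have hr : e.symm.permCongr π ∈ (Equiv.Perm.sumCongrHom (Fin (d + 1)) (Fin (n - d))).range := by
    refine Equiv.Perm.mem_sumCongrHom_range_of_perm_mapsTo_inl fun x hx => ?_
    rw [← he] at hx ⊢
    simpa [Equiv.permCongr_apply] using hπ _ hx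
  obtain ⟨p, hp⟩ := hr
  refine ⟨p, ?_⟩
  change e.permCongr (Equiv.Perm.sumCongrHom _ _ p) = π
  rw [hp]
  ext i
  simp [Equiv.permCongr_apply]

theorem exists_perm_face (F : Face n d) :
    ∃ π : Equiv.Perm (Fin (n + 1)), ∀ i, i ∈ F.1 ↔ (π i : ℕ) < d + 1 := by
  classical
  have hcard : Fintype.card {i // i ∈ F.1} =
      Fintype.card {i : Fin (n + 1) // (i : ℕ) < d + 1} := by
    rw [Fintype.card_coe, F.2]
    refine (Fintype.card_fin (d + 1)).symm.trans <| Fintype.card_congr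
      ⟨fun i => ⟨i.castLE d.2, i.2⟩, fun i => ⟨i.1, i.2⟩, fun _ => rfl, fun _ => rfl⟩
  let e := Fintype.equivOfCardEq hcard
  refine ⟨e.extendSubtype, fun i => ⟨fun h => e.extendSubtype_mem i h, fun h => ?_⟩⟩
  by_contra hi
  exact e.extendSubtype_not_mem i hi h

theorem Face.mem_image {π : Equiv.Perm (Fin (n + 1))} {F : Face n d} {i : Fin (n + 1)} :
    i ∈ (F.image π).1 ↔ π⁻¹ i ∈ F.1 := Finset.mem_map_equiv

/-- The vertices of a face contained in the standard one, as vertices of the latter. -/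
def Face.toFin (F : Face n d) (h : ∀ i ∈ F.1, (i : ℕ) < d + 1) : F.1 ≃ Fin (d + 1) :=
  Equiv.ofBijective (fun i => ⟨i.1, h i.1 i.2⟩) <| by
    rw [Fintype.bijective_iff_injective_and_card]
    refine ⟨fun i j hij => Subtype.ext (Fin.ext (Fin.mk.inj hij)), ?_⟩
    rw [Fintype.card_coe, F.2, Fintype.card_fin]

end faces

/-! ### The face sums are induced representations -/

section faceSum

variable {s : Family} {r : ℤ} {k n : ℕ} {d : Fin (n + 1)}

open Classical in
/-- The inclusion of the boundary-vanishing forms on the standard face into the sum over all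
faces. -/
def standardFaceIncl (s : Family) (r : ℤ) (k : ℕ) (d : Fin (n + 1)) :
    bubble s r k (Fin (d + 1)) →ₗ[ℝ] FaceSum s r k n d :=
  LinearMap.pi fun F => if h : ∀ i ∈ F.1, (i : ℕ) < d + 1 then
    (pullback (F.toFin h)).restrict fun _ => pullback_bubble (F.toFin h) else 0

theorem standardFaceIncl_of_mem (a : bubble s r k (Fin (d + 1))) {F : Face n d}
    (h : ∀ i ∈ F.1, (i : ℕ) < d + 1) :
    (standardFaceIncl s r k d a F).1 = pullback (F.toFin h) a.1 := by
  rw [standardFaceIncl, LinearMap.pi_apply, dif_pos h]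
  rfl

theorem standardFaceIncl_of_not (a : bubble s r k (Fin (d + 1))) {F : Face n d}
    (h : ¬ ∀ i ∈ F.1, (i : ℕ) < d + 1) : standardFaceIncl s r k d a F = 0 := by
  rw [standardFaceIncl, LinearMap.pi_apply, dif_neg h]
  rfl

theorem faceRep_standardFaceIncl_of_mem (π : Equiv.Perm (Fin (n + 1)))
    (a : bubble s r k (Fin (d + 1))) (F : Face n d)
    (h : ∀ i ∈ F.1, (π⁻¹ i : ℕ) < d + 1) :
    (faceRep s r k n d π (standardFaceIncl s r k d a) F).1 =
      pullback (fun i : F.1 => (⟨π⁻¹ i, h i i.2⟩ : Fin (d + 1))) a.1 := by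
  have h' : ∀ i ∈ (F.image π⁻¹).1, (i : ℕ) < d + 1 := fun i hi => by
    have := h _ (Face.mem_image.1 hi)
    simpa using this
  rw [faceRep_apply, standardFaceIncl_of_mem a h', ← pullback_comp]
  rfl

theorem faceRep_standardFaceIncl_of_not (π : Equiv.Perm (Fin (n + 1)))
    (a : bubble s r k (Fin (d + 1))) (F : Face n d)
    (h : ¬ ∀ i ∈ F.1, (π⁻¹ i : ℕ) < d + 1) :
    faceRep s r k n d π (standardFaceIncl s r k d a) F = 0 := by
  have h' : ¬ ∀ i ∈ (F.image π⁻¹).1, (i : ℕ) < d + 1 := fun h' => h fun i hi =>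
    h' _ (Face.mem_image.2 (by simpa using hi))
  refine Subtype.ext ?_
  rw [faceRep_apply, standardFaceIncl_of_not a h']
  exact map_zero _

theorem faceRep_stabilizerHom (p : Equiv.Perm (Fin (d + 1)) × Equiv.Perm (Fin (n - d)))
    (a : bubble s r k (Fin (d + 1))) :
    faceRep s r k n d (stabilizerHom n d p) (standardFaceIncl s r k d a) =
      standardFaceIncl s r k d (bubbleRep s r k (Fin (d + 1)) p.1 a) := by
  funext F
  by_cases h : ∀ i ∈ F.1, (i : ℕ) < d + 1
  · have h' : ∀ i ∈ F.1, ((stabilizerHom n d p)⁻¹ i : ℕ) < d + 1 := fun i hi => by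
      rw [← map_inv]
      exact stabilizerHom_lt _ (h i hi)
    refine Subtype.ext ?_
    rw [faceRep_standardFaceIncl_of_mem _ _ _ h', standardFaceIncl_of_mem _ h]
    change _ = pullback _ (pullback ⇑p.1⁻¹ a.1)
    rw [← pullback_comp]
    congr 2
    funext i
    refine Fin.ext ?_
    have := stabilizerHom_castLE p⁻¹ (F.toFin h i)
    rw [map_inv] at this
    have hval := congrArg Fin.val this
    exact hval
  · have h' : ¬ ∀ i ∈ F.1, ((stabilizerHom n d p)⁻¹ i : ℕ) < d + 1 := fun h' => h fun i hi => by
      have := stabilizerHom_lt p (h' i hi)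
      simpa using this
    rw [faceRep_standardFaceIncl_of_not _ _ _ h', standardFaceIncl_of_not _ h]

theorem faceRep_equiv_inducedRep (s : Family) (r : ℤ) (k n : ℕ) (d : Fin (n + 1)) :
    Nonempty ((faceRep s r k n d).Equiv (inducedRep s r k n d)) := by
  classical
  choose g hg using fun F : Face n d => exists_perm_face F
  have hother : ∀ F F' : Face n d, F ≠ F' → ¬ ∀ i ∈ F.1, ((g F')⁻¹⁻¹ i : ℕ) < d + 1 := by
    intro F F' hne h
    rw [inv_inv] at h
    refine hne (Subtype.ext (Finset.eq_of_subset_of_card_le (fun i hi => (hg F' i).2 (h i hi)) ?_))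
    rw [F.2, F'.2]
  have hself : ∀ F : Face n d, ∀ i ∈ F.1, ((g F)⁻¹⁻¹ i : ℕ) < d + 1 := fun F i hi => by
    rw [inv_inv]
    exact (hg F i).1 hi
  let e : (F : Face n d) → F.1 ≃ Fin (d + 1) := fun F =>
    Equiv.ofBijective (fun i => ⟨(g F)⁻¹⁻¹ i, hself F i i.2⟩) <| by
      rw [Fintype.bijective_iff_injective_and_card]
      refine ⟨fun i j hij => ?_, by rw [Fintype.card_coe, F.2, Fintype.card_fin]⟩
      exact Subtype.ext ((g F)⁻¹⁻¹.injective (Fin.ext (Fin.mk.inj hij)))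
  have hsum : ∀ (a : Face n d → bubble s r k (Fin (d + 1))) (F : Face n d),
      ((∑ F', faceRep s r k n d (g F')⁻¹ (standardFaceIncl s r k d (a F'))) F).1 =
        pullback (e F) (a F).1 := by
    intro a F
    rw [Finset.sum_apply, Finset.sum_eq_single F]
    · exact faceRep_standardFaceIncl_of_mem _ _ _ (hself F)
    · intro F' _ hne
      exact faceRep_standardFaceIncl_of_not _ _ _ (hother F F' hne.symm)
    · exact fun h => absurd (Finset.mem_univ _) h
  have hcancel : ∀ {ι κ : Type} [Fintype ι] [Fintype κ] (e : ι ≃ κ) (ω : Form κ k),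
      pullback e.symm (pullback e ω) = ω := by
    intro ι κ _ _ e ω
    rw [← pullback_comp, Equiv.self_comp_symm, pullback_id]
  refine nonempty_equiv_ind (stabilizerHom n d) _ _ (standardFaceIncl s r k d)
    faceRep_stabilizerHom g (fun y => ?_) ⟨fun a b hab => ?_, fun β => ?_⟩
  · let F₀ : Face n d := ⟨Finset.univ.map (Fin.castLEEmb d.2), by simp⟩
    have hF₀ : ∀ i, i ∈ F₀.1 ↔ (i : ℕ) < d + 1 := fun i => by
      rw [lt_iff_exists_castLE]
      simp [F₀]
    let F := F₀.image y⁻¹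
    have hF : ∀ i, i ∈ F.1 ↔ (y i : ℕ) < d + 1 := fun i => by
      rw [Face.mem_image, inv_inv, hF₀]
    obtain ⟨p, hp⟩ := exists_stabilizerHom_eq (d := d) (π := y * (g F)⁻¹) fun i hi => by
      rw [Equiv.Perm.mul_apply, ← hF, hg]
      simpa using hi
    exact ⟨p, F, by rw [hp, inv_mul_cancel_right]⟩
  · funext F
    refine Subtype.ext ?_
    have := (hsum a F).symm.trans ((congrArg (fun β => (β F).1) hab).trans (hsum b F))
    have hinj : ∀ ω, pullback (e F).symm (pullback (e F) ω) = ω := hcancel (e F)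
    rw [← hinj (a F).1, ← hinj (b F).1, this]
  · refine ⟨fun F => ⟨pullback (e F).symm (β F).1, pullback_bubble _ (β F).2⟩, funext fun F => ?_⟩
    exact Subtype.ext ((hsum _ F).trans (hcancel (e F).symm _))

end faceSum

end

end FEEC

theorem corollary3p12 (s : FEEC.Family) (n k : ℕ) (r : ℤ) (hr : 1 ≤ r) :
    (∃ W, FEEC.IsInvariantComplements (FEEC.space s r k (Fin (n + 1))) W) ∧
    (∀ W, FEEC.IsInvariantComplements (FEEC.space s r k (Fin (n + 1))) W →
      iSupIndep W ∧ ⨆ d, W d = FEEC.space s r k (Fin (n + 1)) ∧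
      ∃ D : (FEEC.spaceRep s r k (Fin (n + 1))).Equiv
          (Representation.directSum fun d : Fin (n + 1) => FEEC.faceRep s r k n d),
        FEEC.IsGeometricDecomposition W D.toLinearMap) ∧
    Nonempty ((Representation.directSum fun d : Fin (n + 1) => FEEC.faceRep s r k n d).Equiv
      (Representation.directSum fun d : Fin (n + 1) => FEEC.inducedRep s r k n d)) := by
  obtain ⟨m, rfl⟩ : ∃ m : ℕ, r = m + 1 := ⟨(r - 1).toNat, by omega⟩
  exact ⟨FEEC.exists_isInvariantComplements s n k _,
    fun W hW => ⟨hW.iSupIndep, hW.iSup_eq, FEEC.exists_isGeometricDecomposition hW⟩,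
    FEEC.nonempty_equiv_directSum _ _ fun d => FEEC.faceRep_equiv_inducedRep s _ k n d⟩
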